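/- **Theorem 3.4 (Linear stability of IMEX-T).** Let $0<\beta<1$, let $\omega^{(\beta)}(z)=\bigl(\tfrac12\tfrac{1+z}{1-z}\bigr)^{\beta}=\sum_{j\ge 0}\omega_j^{(\beta)}z^j$ (principal branch), and let $0<\sigma_1<\sigma_2<\cdots$ and $0<\delta_1<\delta_2<\cdots$ be real exponents. For a step size $h>0$, $t_n=nh$, $m\ge 0$ and exponents $\theta\in\{\sigma,\delta\}$ put $$I^{\beta,n,m}_{h,\theta}g=h^\beta\sum_{k=0}^n\omega^{(\beta)}_{n-k}g_k+h^\beta\sum_{k=1}^mW^{(\beta,\theta)}_{n,k}g_k+h^\beta B^\theta_n g_0,$$ where $W^{(\beta,\theta)}_{n,k}$ and $B_n^\theta$ are determined by $$\sum_{k=1}^mW^{(\beta,\theta)}_{n,k}k^{\theta_r}=\frac{\Gamma(\theta_r+1)}{\Gamma(\theta_r+1+\beta)}n^{\theta_r+\beta}-\sum_{k=0}^n\omega^{(\beta)}_{n-k}k^{\theta_r}\quad(1\le r\le m),\qquad B_n^\theta=\frac{n^\beta}{\Gamma(1+\beta)}-\sum_{k=0}^n\omega^{(\beta)}_{n-k}-\sum_{k=1}^mW^{(\beta,\theta)}_{n,k}.$$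 The scheme IMEX-T for the Caputo equation $D^\beta u=\lambda u+f(t,u)$, with $m_u,m_f,\widetilde m_u,\widetilde m_f\ge 0$ correction terms, is, with $F_k=f(t_k,U_k)$, $$\begin{aligned}U_n=U_0&+\lambda I^{\beta,n,m_u}_{h,\sigma}U+I^{\beta,n,m_f}_{h,\delta}F+h^\beta\omega^{(\beta)}_0\Bigl[-F_n+F_{n-1}+h\,\partial_tf(t_{n-1},U_{n-1})\\&+\partial_uf(t_{n-1},U_{n-1})\Bigl(U_n-U_{n-1}+\sum_{k=1}^{\widetilde m_u}\widetilde W^{(u)}_{n,k}(U_k-U_0)\Bigr)+\sum_{k=1}^{\widetilde m_f}\widetilde W^{(f)}_{n,k}(F_k-F_0)\Bigr],\end{aligned}$$ where $\sum_{k=1}^{\widetilde m_u}\widetilde W^{(u)}_{n,k}k^{\sigma_r}=\sigma_r(n-1)^{\sigma_r-1}-\bigl(n^{\sigma_r}-(n-1)^{\sigma_r}\bigr)$ for $1\le r\le\widetilde m_u$ and $\sum_{k=1}^{\widetilde m_f}\widetilde W^{(f)}_{n,k}k^{\delta_r}=n^{\delta_r}-(n-1)^{\delta_r}-\delta_r(n-1)^{\delta_r-1}$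 for $1\le r\le\widetilde m_f$. Assume that $\sigma_r<2$ for $r\le m_u$, $\delta_r<2$ for $r\le m_f$, $\sigma_r<2+\beta$ for $r\le\widetilde m_u$ and $\delta_r<2+\beta$ for $r\le\widetilde m_f$. Apply IMEX-T to the test equation $D^\beta u=\lambda u+\rho u$, $\lambda,\rho\in\mathbb C$ (that is, $f(t,u)=\rho u$). Let $n_0=\max\{2,1+\max\{m_u,m_f,\widetilde m_u,\widetilde m_f\}\}$. Call the scheme stable for $(\lambda,\rho,h)$ if for every $N\ge n_0$ and all starting values $U_0,\dots,U_{N-1}\in\mathbb C$ the equations of the scheme for $n\ge N$ determine a unique sequence $(U_n)$, and $U_n\to0$ as $n\to\infty$. Then stability depends only on $\xi=(\lambda+\rho)h^\beta$, and the stability region, i.e. the set of all $\xi\in\mathbb{C}$ for which the scheme is stable, is $$\Sigma_\beta^{Num}=\mathbb C\setminus\Bigl\{\frac1{\omega^{(\beta)}(z)}:|z|\le 1\Bigr\},$$ where $1/\omega^{(\beta)}(1)$ is read as $0$ and $z=-1$, a zero of $\omega^{(\beta)}$, contributes no complex number. This is also the stability region of the underlying fractional linear multistep method, i.e. the set of all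 $\xi$ such that for every convergent sequence $(g_n)$ the equations $y_n=g_n+\xi\sum_{j=0}^n\omega^{(\beta)}_{n-j}y_j$, $n\ge 0$, determine a unique sequence $(y_n)$, and $y_n\to0$. In particular, IMEX-T is $A(\tfrac{\beta\pi}2)$-stable: $\{s\in\mathbb C\setminus\{0\}:|\arg s|>\tfrac{\beta\pi}2\}\subseteq\Sigma_\beta^{Num}$. -/

import Mathlib

open Filter Topology

noncomputable section

namespace IMEXT

/-! ### Fractional linear multistep weights -/

/-- The generating function `ω^{(β)}(z) = ((1/2) (1 + z) / (1 - z)) ^ β` (principal branch: for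
`|z| ≤ 1`, `z ≠ 1`, the base lies in the closed right half plane). -/
def genFun (β : ℝ) (z : ℂ) : ℂ := (1 / 2 * ((1 + z) / (1 - z))) ^ (β : ℂ)

/-- `ω_n^{(β)}`, the `n`-th Taylor coefficient of the generating function at `0`. -/
def omega (β : ℝ) (n : ℕ) : ℂ := iteratedDeriv n (genFun β) 0 / (n.factorial : ℂ)

/-! ### Starting weights

A sequence of exponents `θ_1 < θ_2 < ⋯` is stored as `θ : ℕ → ℝ` with `θ r` standing for
`θ_{r+1}`; correspondingly the index `k : Fin m` of a starting weight stands for the grid index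
`k + 1 ∈ {1, …, m}`. -/

/-- The matrix with the entries `k ^ θ_r`, `1 ≤ r, k ≤ m`. -/
def nodeMatrix (θ : ℕ → ℝ) (m : ℕ) : Matrix (Fin m) (Fin m) ℝ :=
  Matrix.of fun r k => ((k : ℝ) + 1) ^ θ r

/-- The solution `(w_1, …, w_m)` of the linear system `∑ k = 1..m, w_k k ^ θ_r = b_r`,
`1 ≤ r ≤ m`; see `solveWeights_spec`. -/
def solveWeights (θ : ℕ → ℝ) (m : ℕ) (b : ℕ → ℂ) (k : Fin m) : ℂ :=
  ∑ r : Fin m, (((nodeMatrix θ m)⁻¹ k r : ℝ) : ℂ) * b r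

theorem expSum_eq_zero (m : ℕ) : ∀ (a c x : Fin m → ℝ), Function.Injective a → StrictMono x →
    (∀ i, ∑ r, c r * Real.exp (a r * x i) = 0) → c = 0 := by
  induction m with
  | zero => intro a c x _ _ _; exact Subsingleton.elim _ _
  | succ m ih =>
    intro a c x ha hx h
    have hder : ∀ t : ℝ, HasDerivAt (fun t => ∑ r, c r * Real.exp ((a r - a 0) * t))
        (∑ r, c r * (Real.exp ((a r - a 0) * t) * (a r - a 0))) t := by
      intro t
      refine HasDerivAt.fun_sum fun r _ => ?_
      have h1 : HasDerivAt (fun t : ℝ => (a r - a 0) * t) (a r - a 0) t := by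
        simpa using (hasDerivAt_id t).const_mul (a r - a 0)
      exact (h1.exp).const_mul (c r)
    have hz : ∀ i, ∑ r, c r * Real.exp ((a r - a 0) * x i) = 0 := by
      intro i
      have h2 : ∑ r, c r * Real.exp ((a r - a 0) * x i)
          = (∑ r, c r * Real.exp (a r * x i)) * Real.exp (-(a 0 * x i)) := by
        rw [Finset.sum_mul]
        refine Finset.sum_congr rfl fun r _ => ?_
        rw [mul_assoc, ← Real.exp_add]
        ring_nf
      rw [h2, h i, zero_mul]
    have hrolle : ∀ i : Fin m, ∃ y ∈ Set.Ioo (x i.castSucc) (x i.succ),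
        ∑ r, c r * (Real.exp ((a r - a 0) * y) * (a r - a 0)) = 0 := by
      intro i
      refine exists_hasDerivAt_eq_zero (hx (Fin.castSucc_lt_succ))
        (fun t _ => (hder t).continuousAt.continuousWithinAt) ?_ (fun t _ => hder t)
      rw [hz, hz]
    choose y hy hy0 using hrolle
    have hymono : StrictMono y := by
      intro i j hij
      calc y i < x i.succ := (hy i).2
        _ ≤ x j.castSucc := hx.monotone (Fin.succ_le_castSucc_iff.mpr hij)
        _ < y j := (hy j).1
    have hc := ih (fun r => a r.succ - a 0) (fun r => c r.succ * (a r.succ - a 0)) y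
      (fun r s hrs => Fin.succ_injective _ (ha (sub_left_injective hrs))) hymono (by
        intro i
        have h3 := hy0 i
        rw [Fin.sum_univ_succ, sub_self, mul_zero, mul_zero, zero_add] at h3
        rw [← h3]
        refine Finset.sum_congr rfl fun r _ => ?_
        ring)
    have hsucc : ∀ r : Fin m, c r.succ = 0 := by
      intro r
      have h4 : c r.succ * (a r.succ - a 0) = 0 := congrFun hc r
      rcases mul_eq_zero.mp h4 with h5 | h5
      · exact h5
      · exact absurd (ha (sub_eq_zero.mp h5)) (Fin.succ_ne_zero r)
    have h0 := h 0
    rw [Fin.sum_univ_succ] at h0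
    simp only [hsucc, zero_mul, Finset.sum_const_zero, add_zero] at h0
    have hc0 : c 0 = 0 := (mul_eq_zero.mp h0).resolve_right (Real.exp_ne_zero _)
    funext r
    refine Fin.cases hc0 hsucc r

theorem nodeMatrix_det_ne_zero {θ : ℕ → ℝ} (hθ : StrictMono θ) (m : ℕ) :
    (nodeMatrix θ m).det ≠ 0 := by
  intro hdet
  obtain ⟨v, hv, hv0⟩ := Matrix.exists_vecMul_eq_zero_iff.mpr hdet
  refine hv (expSum_eq_zero m (fun r => θ r) v (fun k => Real.log ((k : ℝ) + 1))
    (fun r s hrs => Fin.ext (hθ.injective hrs)) (fun i j hij => ?_) fun i => ?_)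
  · refine Real.log_lt_log (by positivity) ?_
    have : ((i : ℕ) : ℝ) < (j : ℕ) := by exact_mod_cast hij
    linarith
  · have h1 := congrFun hv0 i
    simp only [Matrix.vecMul, dotProduct, nodeMatrix, Matrix.of_apply, Pi.zero_apply] at h1
    rw [← h1]
    refine Finset.sum_congr rfl fun r _ => ?_
    rw [Real.rpow_def_of_pos (by positivity), mul_comm (θ r)]

theorem solveWeights_spec {θ : ℕ → ℝ} (hθ : StrictMono θ) (m : ℕ) (b : ℕ → ℂ) (r : Fin m) :
    ∑ k : Fin m, solveWeights θ m b k * ((((k : ℝ) + 1) ^ θ r : ℝ) : ℂ) = b r := by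
  have hinv : nodeMatrix θ m * (nodeMatrix θ m)⁻¹ = 1 :=
    Matrix.mul_nonsing_inv _ (isUnit_iff_ne_zero.mpr (nodeMatrix_det_ne_zero hθ m))
  simp only [solveWeights, Finset.sum_mul]
  rw [Finset.sum_comm]
  have key : ∀ s : Fin m, ∑ k : Fin m,
      ((((nodeMatrix θ m)⁻¹ k s : ℝ) : ℂ) * b s * ((((k : ℝ) + 1) ^ θ r : ℝ) : ℂ))
        = (((1 : Matrix (Fin m) (Fin m) ℝ) r s : ℝ) : ℂ) * b s := by
    intro s
    rw [← hinv, Matrix.mul_apply, Complex.ofReal_sum, Finset.sum_mul]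
    refine Finset.sum_congr rfl fun k _ => ?_
    simp only [nodeMatrix, Matrix.of_apply, Complex.ofReal_mul]
    ring
  rw [Finset.sum_congr rfl fun s _ => key s]
  simp [Matrix.one_apply, apply_ite (fun x : ℝ => (x : ℂ)), ite_mul]

/-- The starting weights `W_{n,k}^{(β,θ)}`, which make the corrected quadrature exact for
`t ^ θ_r`, `1 ≤ r ≤ m`. -/
def quadWeight (β : ℝ) (θ : ℕ → ℝ) (m n : ℕ) : Fin m → ℂ :=
  solveWeights θ m fun r =>
    ((Real.Gamma (θ r + 1) / Real.Gamma (θ r + 1 + β) * (n : ℝ) ^ (θ r + β) : ℝ) : ℂ)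
      - ∑ k ∈ Finset.range (n + 1), omega β (n - k) * (((k : ℝ) ^ θ r : ℝ) : ℂ)

/-- The weight `B_n^θ`, which makes the corrected quadrature exact for constants. -/
def quadWeightZero (β : ℝ) (θ : ℕ → ℝ) (m n : ℕ) : ℂ :=
  (((n : ℝ) ^ β / Real.Gamma (1 + β) : ℝ) : ℂ)
    - ∑ k ∈ Finset.range (n + 1), omega β (n - k) - ∑ k : Fin m, quadWeight β θ m n k

/-- The corrected quadrature `I_{h,θ}^{β,n,m} g` of a grid function `g k = g(t_k)`. -/
def fracQuad (β h : ℝ) (θ : ℕ → ℝ) (m n : ℕ) (g : ℕ → ℂ) : ℂ :=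
  ((h ^ β : ℝ) : ℂ) * ∑ k ∈ Finset.range (n + 1), omega β (n - k) * g k
    + ((h ^ β : ℝ) : ℂ) * ∑ k : Fin m, quadWeight β θ m n k * g (k + 1)
    + ((h ^ β : ℝ) : ℂ) * quadWeightZero β θ m n * g 0

/-- The weights `\tilde W_{n,k}^{(f)}` correcting the Taylor expansion
`g(t_n) ≈ g(t_{n-1}) + h g'(t_{n-1})`. -/
def taylorWeightF (δ : ℕ → ℝ) (m n : ℕ) : Fin m → ℂ :=
  solveWeights δ m fun r =>
    (((n : ℝ) ^ δ r - ((n : ℝ) - 1) ^ δ r - δ r * ((n : ℝ) - 1) ^ (δ r - 1) : ℝ) : ℂ)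

/-- The weights `\tilde W_{n,k}^{(u)}` correcting the difference quotient
`g'(t_{n-1}) ≈ (g(t_n) - g(t_{n-1})) / h`. -/
def taylorWeightU (σ : ℕ → ℝ) (m n : ℕ) : Fin m → ℂ :=
  solveWeights σ m fun r =>
    ((σ r * ((n : ℝ) - 1) ^ (σ r - 1) - ((n : ℝ) ^ σ r - ((n : ℝ) - 1) ^ σ r) : ℝ) : ℂ)

/-! ### The IMEX-T scheme for `D^β u = λ u + f(t, u)` -/

/-- The data of the correction terms: the exponents `σ_1 < σ_2 < ⋯` (used for `u`) and
`δ_1 < δ_2 < ⋯` (used for `f`), and the numbers of terms `m_u, m_f, \tilde m_u, \tilde m_f`, the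
latter two being `mu'`, `mf'`. -/
structure Corrections where
  σ : ℕ → ℝ
  δ : ℕ → ℝ
  mu : ℕ
  mf : ℕ
  mu' : ℕ
  mf' : ℕ

/-- The first time level that can be computed: at least `2`, and beyond all the levels that enter
the correction terms. -/
def Corrections.firstLevel (C : Corrections) : ℕ :=
  max 2 (1 + max (max C.mu C.mf) (max C.mu' C.mf'))

/-- The equation of IMEX-T for the time level `n`, with step size `h` and `t_n = n h`. -/
def SchemeEq (β h : ℝ) (C : Corrections) (lam : ℂ) (f : ℝ → ℂ → ℂ) (U : ℕ → ℂ) (n : ℕ) : Prop :=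
  let F : ℕ → ℂ := fun k => f (k * h) (U k)
  let s : ℝ := ((n - 1 : ℕ) : ℝ) * h
  U n = U 0 + lam * fracQuad β h C.σ C.mu n U + fracQuad β h C.δ C.mf n F
    + ((h ^ β : ℝ) : ℂ) * omega β 0 *
      (-F n + F (n - 1) + (h : ℂ) * deriv (fun t : ℝ => f t (U (n - 1))) s
        + deriv (fun x : ℂ => f s x) (U (n - 1)) *
          (U n - U (n - 1) + ∑ k : Fin C.mu', taylorWeightU C.σ C.mu' n k * (U (k + 1) - U 0))
        + ∑ k : Fin C.mf', taylorWeightF C.δ C.mf' n k * (F (k + 1) - F 0))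

/-- `U` is computed by IMEX-T from the time level `N` on, with the starting values
`V 0, …, V (N - 1)`, for the test equation `D^β u = λ u + ρ u`, i.e. `f(t, u) = ρ u`. -/
def IsTestRun (β h : ℝ) (C : Corrections) (lam rho : ℂ) (N : ℕ) (V U : ℕ → ℂ) : Prop :=
  (∀ k < N, U k = V k) ∧ ∀ n, N ≤ n → SchemeEq β h C lam (fun _ u => rho * u) U n

/-- IMEX-T is stable for the test equation with the data `λ, ρ, h`: wherever it is started, and
from whatever starting values, it determines a unique numerical solution, which tends to `0`. -/
def IsStableFor (β h : ℝ) (C : Corrections) (lam rho : ℂ) : Prop :=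
  ∀ N, C.firstLevel ≤ N → ∀ V : ℕ → ℂ, ∃ U : ℕ → ℂ, IsTestRun β h C lam rho N V U ∧
    (∀ U', IsTestRun β h C lam rho N V U' → U' = U) ∧ Tendsto U atTop (𝓝 0)

/-- The stability region of IMEX-T in terms of `ξ = (λ + ρ) h ^ β`. -/
def stabilityRegion (β : ℝ) (C : Corrections) : Set ℂ :=
  {ξ | ∀ (lam rho : ℂ) (h : ℝ), 0 < h → (lam + rho) * ((h ^ β : ℝ) : ℂ) = ξ →
    IsStableFor β h C lam rho}

/-! ### Stability of convolution quadratures, and sectors -/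

/-- The stability region of the convolution quadrature `y_n = g_n + ξ ∑ j ≤ n, w_{n-j} y_j`: the
`ξ` such that, for every convergent `g`, it determines a unique `y`, which tends to `0`. -/
def convStabilityRegion (w : ℕ → ℂ) : Set ℂ :=
  {ξ | ∀ (g : ℕ → ℂ) (l : ℂ), Tendsto g atTop (𝓝 l) → ∃ y : ℕ → ℂ,
    (∀ n, y n = g n + ξ * ∑ j ∈ Finset.range (n + 1), w (n - j) * y j) ∧
    (∀ y' : ℕ → ℂ, (∀ n, y' n = g n + ξ * ∑ j ∈ Finset.range (n + 1), w (n - j) * y' j) →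
      y' = y) ∧
    Tendsto y atTop (𝓝 0)}

/-- The set `{1 / ω^{(β)}(z) : |z| ≤ 1}`. At `z = 1`, where `ω^{(β)}` is infinite, the reciprocal
is `0`; at `z = -1`, where `ω^{(β)}` vanishes, it is not a complex number. -/
def reciprocalValues (β : ℝ) : Set ℂ :=
  insert 0 {ξ | ∃ z : ℂ, ‖z‖ ≤ 1 ∧ z ≠ 1 ∧ z ≠ -1 ∧ ξ = 1 / genFun β z}

/-- `A(α)`-stability: the stability region contains the sector `|arg s| > α`. -/
def IsAStable (α : ℝ) (R : Set ℂ) : Prop := {s : ℂ | α < |s.arg|} ⊆ R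

end IMEXT

end

/-!
For the test equation the terms `F_n`, `F_{n-1}` and the Taylor expansion of `f` cancel, and since
the correction terms involve only starting values, IMEX-T is a discrete Volterra equation
`U = g + ξ ω * U` with `ξ = (λ + ρ) h ^ β`, where the forcing `g` is a combination of starting values
with coefficients that depend on `n`. As formal power series, `(1 - ξ ω) U = g`. The singularity of
`ω` at `1` is removed by the factor `(1 - X) ^ β`: by `omegaSeries_mul`,
`(1 - X) ^ β (1 - ξ ω) = (1 - X) ^ β - ξ ((1 + X) / 2) ^ β`, and this characteristic series
(`charSeries`) converges absolutely on the closed disc. It has a zero there exactly if `ξ` is one of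
the reciprocal values `1 / ω(z)`.

*Decay off the reciprocal values.* By Wiener's lemma (`wienerNorm_inv_ne_top`) the characteristic
series has an absolutely summable inverse, so that `U` tends to `0` if `(1 - X) ^ β g` does
(`tendsto_zero_of_volterra`). This is easy for convergent `g`, which settles the linear multistep
method. For IMEX-T the forcing may grow, up to an exponent less than `β`; it is a combination of the
quadrature errors for `t ^ θ`, `0 ≤ θ < 2`, and of the Taylor errors for `t ^ δ`, `δ < 2 + β`
(`fracNull_quadError`, `fracNull_taylorError`). Their fractional differences are computed from the
expansion of `n ^ p / Γ(p + 1)` into the coefficients of `(1 - X) ^ (-p - 1)` and `(1 - X) ^ (-p)`, on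
which `(1 - X) ^ β` acts exactly; the remainder is regular enough for its fractional difference to
vanish in the limit (`isBigO_gridRem`, `vanishing_oneSubPow_mul`). The coefficients of the expansion
cancel because the underlying method has order two (`vanishing_quadrature_error`).

*No decay on the reciprocal values.* If the characteristic series vanishes at `z ≠ ±1`, then a
solution with monomial forcing cannot tend to `0`, by comparison of both sides along the radius to
`z` (`not_vanishing_of_root`); starting values that inactivate the corrections produce such a
forcing. For `ξ = 0` constants are solutions.

The sector is contained in the stability region since the base of the power `ω(z)` lies in the
closed right half plane.
-/

noncomputable section

namespace IMEXT

open PowerSeries Asymptotics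
open scoped ENNReal

/-! ### The Wiener norm of a power series -/

/-- The `ℓ¹` norm of the coefficients, with value `⊤` if they are not absolutely summable. -/
def wienerNorm (f : ℂ⟦X⟧) : ℝ≥0∞ := ∑' n, ‖coeff n f‖ₑ

theorem enorm_coeff_le_wienerNorm (f : ℂ⟦X⟧) (n : ℕ) : ‖coeff n f‖ₑ ≤ wienerNorm f :=
  ENNReal.le_tsum n

theorem wienerNorm_add_le (f g : ℂ⟦X⟧) : wienerNorm (f + g) ≤ wienerNorm f + wienerNorm g := by
  rw [wienerNorm, wienerNorm, wienerNorm, ← ENNReal.tsum_add]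
  exact ENNReal.tsum_le_tsum fun n => by rw [map_add]; exact enorm_add_le _ _

theorem wienerNorm_neg (f : ℂ⟦X⟧) : wienerNorm (-f) = wienerNorm f := by
  simp [wienerNorm]

theorem wienerNorm_C (c : ℂ) : wienerNorm (C c) = ‖c‖ₑ := by
  rw [wienerNorm, tsum_eq_single 0]
  · simp
  · intro n hn
    simp [coeff_C, hn]

theorem wienerNorm_one : wienerNorm 1 = 1 := by
  simpa using wienerNorm_C 1

theorem wienerNorm_X : wienerNorm X = 1 := by
  rw [wienerNorm, tsum_eq_single 1]
  · simp
  · intro n hn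
    simp [coeff_X, hn]

theorem wienerNorm_mul_le (f g : ℂ⟦X⟧) : wienerNorm (f * g) ≤ wienerNorm f * wienerNorm g := by
  calc wienerNorm (f * g)
      ≤ ∑' n, ∑ p ∈ Finset.HasAntidiagonal.antidiagonal n, ‖coeff p.1 f‖ₑ * ‖coeff p.2 g‖ₑ := by
        refine ENNReal.tsum_le_tsum fun n => ?_
        rw [coeff_mul]
        refine (enorm_sum_le _ _).trans (Finset.sum_le_sum fun p _ => ?_)
        rw [enorm_mul]
    _ = ∑' p : ℕ × ℕ, ‖coeff p.1 f‖ₑ * ‖coeff p.2 g‖ₑ := by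
        rw [← Finset.HasAntidiagonal.sigmaAntidiagonalEquivProd.tsum_eq, ENNReal.tsum_sigma']
        refine tsum_congr fun n => ?_
        rw [tsum_fintype, ← Finset.sum_attach, ← Finset.univ_eq_attach]
        rfl
    _ = wienerNorm f * wienerNorm g := by
        rw [ENNReal.tsum_prod', wienerNorm, wienerNorm, ← ENNReal.tsum_mul_right]
        exact tsum_congr fun n => by dsimp only; rw [ENNReal.tsum_mul_left]

theorem wienerNorm_pow_le (f : ℂ⟦X⟧) (k : ℕ) : wienerNorm (f ^ k) ≤ wienerNorm f ^ k := by
  induction k with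
  | zero => simp [wienerNorm_one]
  | succ k ih =>
    rw [pow_succ, pow_succ]
    exact (wienerNorm_mul_le _ _).trans (by gcongr)

theorem wienerNorm_sum_le {ι : Type*} (s : Finset ι) (f : ι → ℂ⟦X⟧) :
    wienerNorm (∑ i ∈ s, f i) ≤ ∑ i ∈ s, wienerNorm (f i) := by
  classical
  induction s using Finset.induction_on with
  | empty => simp [wienerNorm]
  | insert a s ha ih =>
    rw [Finset.sum_insert ha, Finset.sum_insert ha]
    exact (wienerNorm_add_le _ _).trans (by gcongr)

theorem summable_norm_coeff {f : ℂ⟦X⟧} (hf : wienerNorm f ≠ ⊤) :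
    Summable fun n => ‖coeff n f‖ := by
  have h := ENNReal.summable_toReal hf
  simpa using h

theorem wienerNorm_ne_top_of_summable {f : ℂ⟦X⟧} (hf : Summable fun n => ‖coeff n f‖) :
    wienerNorm f ≠ ⊤ := by
  have h := hf.tsum_ofReal_ne_top
  simpa [wienerNorm, ofReal_norm] using h

/-! ### Evaluation on the unit disc -/

/-- The value of a power series at `z` (the junk value `0` of `tsum` where it diverges). -/
def eval (f : ℂ⟦X⟧) (z : ℂ) : ℂ := ∑' n, coeff n f * z ^ n

/-- Absolute convergence of a power series at `z`. -/
def AbsConvAt (f : ℂ⟦X⟧) (z : ℂ) : Prop := Summable fun n => ‖coeff n f * z ^ n‖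

theorem absConvAt_of_bounded {f : ℂ⟦X⟧} {z : ℂ} {M : ℝ} (hM : ∀ n, ‖coeff n f‖ ≤ M)
    (hz : ‖z‖ < 1) : AbsConvAt f z := by
  refine Summable.of_nonneg_of_le (fun _ => norm_nonneg _) (fun n => ?_)
    ((summable_geometric_of_lt_one (norm_nonneg z) hz).mul_left M)
  rw [norm_mul, norm_pow]
  have := hM n
  gcongr

theorem absConvAt_of_wienerNorm {f : ℂ⟦X⟧} {z : ℂ} (hf : wienerNorm f ≠ ⊤)
    (hz : ‖z‖ ≤ 1) : AbsConvAt f z := by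
  refine Summable.of_nonneg_of_le (fun _ => norm_nonneg _) (fun n => ?_) (summable_norm_coeff hf)
  rw [norm_mul, norm_pow]
  exact mul_le_of_le_one_right (norm_nonneg _) (pow_le_one₀ (norm_nonneg _) hz)

theorem AbsConvAt.hasSum {f : ℂ⟦X⟧} {z : ℂ} (hf : AbsConvAt f z) :
    HasSum (fun n => coeff n f * z ^ n) (eval f z) :=
  hf.of_norm.hasSum

theorem coeff_mul_mul_pow (f g : ℂ⟦X⟧) (z : ℂ) (n : ℕ) : coeff n (f * g) * z ^ n =
    ∑ p ∈ Finset.HasAntidiagonal.antidiagonal n, (coeff p.1 f * z ^ p.1) * (coeff p.2 g * z ^ p.2) := by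
  rw [coeff_mul, Finset.sum_mul]
  refine Finset.sum_congr rfl fun p hp => ?_
  rw [← Finset.HasAntidiagonal.mem_antidiagonal.mp hp, pow_add]
  ring

theorem AbsConvAt.mul {f g : ℂ⟦X⟧} {z : ℂ} (hf : AbsConvAt f z) (hg : AbsConvAt g z) :
    AbsConvAt (f * g) z := by
  simpa only [AbsConvAt, coeff_mul_mul_pow] using
    summable_norm_sum_mul_antidiagonal_of_summable_norm hf hg

theorem AbsConvAt.eval_mul {f g : ℂ⟦X⟧} {z : ℂ} (hf : AbsConvAt f z) (hg : AbsConvAt g z) :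
    eval (f * g) z = eval f z * eval g z := by
  simp only [eval, coeff_mul_mul_pow]
  exact (tsum_mul_tsum_eq_tsum_sum_antidiagonal_of_summable_norm hf hg).symm

theorem AbsConvAt.add {f g : ℂ⟦X⟧} {z : ℂ} (hf : AbsConvAt f z) (hg : AbsConvAt g z) :
    AbsConvAt (f + g) z := by
  refine Summable.of_nonneg_of_le (fun _ => norm_nonneg _) (fun n => ?_) (Summable.add hf hg)
  rw [map_add, add_mul]
  exact norm_add_le _ _

theorem AbsConvAt.eval_add {f g : ℂ⟦X⟧} {z : ℂ} (hf : AbsConvAt f z) (hg : AbsConvAt g z) :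
    eval (f + g) z = eval f z + eval g z := by
  rw [eval, eval, eval, ← hf.of_norm.tsum_add hg.of_norm]
  exact tsum_congr fun n => by rw [map_add, add_mul]

theorem hasSum_eval_polynomial (P : Polynomial ℂ) (z : ℂ) :
    HasSum (fun n => coeff n (P : ℂ⟦X⟧) * z ^ n) (P.eval z) := by
  rw [Polynomial.eval_eq_sum, Polynomial.sum]
  simp only [Polynomial.coeff_coe]
  refine hasSum_sum_of_ne_finset_zero fun n hn => ?_
  rw [Polynomial.notMem_support_iff.mp hn, zero_mul]

theorem eval_polynomial (P : Polynomial ℂ) (z : ℂ) : eval (P : ℂ⟦X⟧) z = P.eval z :=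
  (hasSum_eval_polynomial P z).tsum_eq

theorem absConvAt_polynomial (P : Polynomial ℂ) (z : ℂ) : AbsConvAt (P : ℂ⟦X⟧) z := by
  refine summable_of_hasFiniteSupport ((Finset.finite_toSet P.support).subset fun n hn => ?_)
  rw [Finset.mem_coe, Polynomial.mem_support_iff]
  rintro h
  simp [h] at hn

theorem hasFPowerSeriesAt_ofScalars {f : ℂ⟦X⟧} {F : ℂ → ℂ}
    (h : ∀ᶠ z in 𝓝 0, HasSum (fun n => coeff n f * z ^ n) (F z)) :
    HasFPowerSeriesAt F (FormalMultilinearSeries.ofScalars ℂ fun n => coeff n f) 0 := by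
  rw [hasFPowerSeriesAt_iff]
  filter_upwards [h] with z hz
  simpa [FormalMultilinearSeries.coeff_ofScalars, mul_comm] using hz

/-- The coefficients are determined by the values near `0`. -/
theorem eq_of_eventually_hasSum {f g : ℂ⟦X⟧} {F : ℂ → ℂ}
    (hf : ∀ᶠ z in 𝓝 0, HasSum (fun n => coeff n f * z ^ n) (F z))
    (hg : ∀ᶠ z in 𝓝 0, HasSum (fun n => coeff n g * z ^ n) (F z)) : f = g := by
  have h := (hasFPowerSeriesAt_ofScalars hf).eq_formalMultilinearSeries
    (hasFPowerSeriesAt_ofScalars hg)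
  have h2 := (FormalMultilinearSeries.ofScalars_series_eq_iff (𝕜 := ℂ) (E := ℂ) _ _).mp h
  ext n
  exact congrFun h2 n

/-! ### Power series with coefficients tending to zero -/

/-- The coefficients tend to `0`. -/
def Vanishing (f : ℂ⟦X⟧) : Prop := Tendsto (fun n => coeff n f) atTop (𝓝 0)

theorem Vanishing.add {f g : ℂ⟦X⟧} (hf : Vanishing f) (hg : Vanishing g) : Vanishing (f + g) := by
  simpa [Vanishing] using Tendsto.add hf hg

theorem Vanishing.C_mul {f : ℂ⟦X⟧} (hf : Vanishing f) (c : ℂ) : Vanishing (C c * f) := by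
  simpa [Vanishing] using Tendsto.const_mul c hf

theorem Vanishing.sub {f g : ℂ⟦X⟧} (hf : Vanishing f) (hg : Vanishing g) : Vanishing (f - g) := by
  simpa [Vanishing] using Tendsto.sub hf hg

theorem vanishing_of_wienerNorm {f : ℂ⟦X⟧} (hf : wienerNorm f ≠ ⊤) : Vanishing f :=
  tendsto_zero_iff_norm_tendsto_zero.mpr (summable_norm_coeff hf).tendsto_atTop_zero

theorem Vanishing.exists_bound {f : ℂ⟦X⟧} (hf : Vanishing f) : ∃ M, ∀ n, ‖coeff n f‖ ≤ M := by
  obtain ⟨M, hM⟩ := (Metric.isBounded_range_of_tendsto _ hf).exists_norm_le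
  exact ⟨M, fun n => hM _ ⟨n, rfl⟩⟩

/-- Convolution with an `ℓ¹` sequence preserves null sequences. -/
theorem Vanishing.mul_left {f g : ℂ⟦X⟧} (hf : wienerNorm f ≠ ⊤) (hg : Vanishing g) :
    Vanishing (f * g) := by
  obtain ⟨M, hM⟩ := hg.exists_bound
  have hM0 : 0 ≤ M := (norm_nonneg _).trans (hM 0)
  have key : Tendsto (fun n => ∑' i, if i ≤ n then coeff i f * coeff (n - i) g else 0) atTop
      (𝓝 (∑' _ : ℕ, (0 : ℂ))) := by
    refine tendsto_tsum_of_dominated_convergence (bound := fun i => ‖coeff i f‖ * M)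
      ((summable_norm_coeff hf).mul_right M) (fun i => ?_) (Eventually.of_forall fun n i => ?_)
    · have h1 : Tendsto (fun n => coeff i f * coeff (n - i) g) atTop (𝓝 (coeff i f * 0)) :=
        (Tendsto.comp hg (tendsto_sub_atTop_nat i)).const_mul _
      rw [mul_zero] at h1
      refine h1.congr' ?_
      filter_upwards [eventually_ge_atTop i] with n hn
      rw [if_pos hn]
    · split_ifs
      · rw [norm_mul]
        have := hM (n - i)
        gcongr
      · simpa using mul_nonneg (norm_nonneg _) hM0
  rw [tsum_zero] at key
  refine key.congr fun n => ?_
  rw [coeff_mul, Finset.Nat.sum_antidiagonal_eq_sum_range_succ (fun i j => coeff i f * coeff j g),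
    tsum_eq_sum (s := Finset.range n.succ)]
  · exact Finset.sum_congr rfl fun i hi => if_pos (Nat.lt_succ_iff.mp (Finset.mem_range.mp hi))
  · intro i hi
    rw [if_neg]
    simpa [Nat.lt_succ_iff] using hi

/-! ### Wiener's lemma -/

theorem hasSum_coeff_one (z : ℂ) : HasSum (fun n => coeff n (1 : ℂ⟦X⟧) * z ^ n) 1 := by
  simpa using hasSum_eval_polynomial 1 z

theorem continuousOn_eval {f : ℂ⟦X⟧} (hf : wienerNorm f ≠ ⊤) :
    ContinuousOn (eval f) (Metric.closedBall 0 1) := by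
  refine continuousOn_tsum (fun n => by fun_prop) (summable_norm_coeff hf) fun n z hz => ?_
  rw [norm_mul, norm_pow]
  exact mul_le_of_le_one_right (norm_nonneg _)
    (pow_le_one₀ (norm_nonneg _) (mem_closedBall_zero_iff.mp hz))

theorem enorm_eval_le (f : ℂ⟦X⟧) {z : ℂ} (hz : ‖z‖ ≤ 1) : ‖eval f z‖ₑ ≤ wienerNorm f := by
  refine (enorm_tsum_le_tsum_enorm).trans (ENNReal.tsum_le_tsum fun n => ?_)
  rw [enorm_mul, enorm_pow]
  refine mul_le_of_le_one_right' (pow_le_one' ?_ _)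
  rw [← ofReal_norm]
  exact ENNReal.ofReal_le_one.mpr hz

/-- By Cauchy's estimates on a circle of radius `R > 1`, the Wiener norms of the powers of `P⁻¹`
grow at most at the rate given by the minimum of `|P|` on the disc of radius `R`. -/
theorem wienerNorm_inv_polynomial_pow_le {P : Polynomial ℂ} {R m : ℝ} (hR : 1 < R) (hm : 0 < m)
    (hP : ∀ z : ℂ, ‖z‖ ≤ R → m ≤ ‖P.eval z‖) (K : ℕ) :
    wienerNorm ((P : ℂ⟦X⟧)⁻¹ ^ K) ≤
      ENNReal.ofReal m⁻¹ ^ K * (1 - ENNReal.ofReal R⁻¹)⁻¹ := by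
  have hR0 : 0 < R := by linarith
  have hP0 : ∀ z : ℂ, ‖z‖ ≤ R → P.eval z ≠ 0 := fun z hz h => by
    have := hP z hz
    rw [h, norm_zero] at this
    linarith
  set F : ℂ → ℂ := fun z => (P.eval z)⁻¹ ^ K with hF
  have hdiff : DifferentiableOn ℂ F (Metric.closedBall 0 R) := fun z hz =>
    ((P.differentiable.differentiableAt.inv
      (hP0 z (mem_closedBall_zero_iff.mp hz))).pow K).differentiableWithinAt
  set T : ℂ⟦X⟧ := PowerSeries.mk fun n => iteratedDeriv n F 0 / (n.factorial : ℂ) with hT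
  have hbound : ∀ n, ‖coeff n T‖ ≤ m⁻¹ ^ K * R⁻¹ ^ n := by
    intro n
    have h1 : ‖iteratedDeriv n F 0‖ ≤ n.factorial * m⁻¹ ^ K / R ^ n := by
      refine Complex.norm_iteratedDeriv_le_of_forall_mem_sphere_norm_le n hR0
        (hdiff.diffContOnCl_ball subset_rfl) fun z hz => ?_
      have hz' : ‖z‖ ≤ R := (mem_sphere_zero_iff_norm.mp hz).le
      rw [hF, norm_pow, norm_inv]
      have := hP z hz'
      gcongr
    rw [hT, coeff_mk, norm_div, Complex.norm_natCast, div_le_iff₀ (by positivity)]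
    refine h1.trans (le_of_eq ?_)
    rw [inv_pow R]
    ring
  have hsum : ∀ z : ℂ, ‖z‖ < R → HasSum (fun n => coeff n T * z ^ n) (F z) := by
    intro z hz
    have h1 := Complex.hasSum_taylorSeries_on_ball
      (hdiff.mono Metric.ball_subset_closedBall) (mem_ball_zero_iff.mpr hz)
    convert! h1 using 2 with n
    rw [hT, coeff_mk, sub_zero, smul_eq_mul, smul_eq_mul]
    field_simp
  have habs : ∀ z : ℂ, ‖z‖ < 1 → AbsConvAt T z := fun z hz =>
    absConvAt_of_bounded (M := m⁻¹ ^ K) (fun n => (hbound n).trans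
      (mul_le_of_le_one_right (by positivity)
        (pow_le_one₀ (by positivity) (inv_le_one_of_one_le₀ hR.le)))) hz
  have hmul : (P : ℂ⟦X⟧) ^ K * T = 1 := by
    refine eq_of_eventually_hasSum (F := fun _ => 1) ?_
      (Eventually.of_forall hasSum_coeff_one)
    filter_upwards [Metric.ball_mem_nhds (0 : ℂ) one_pos] with z hz
    rw [mem_ball_zero_iff] at hz
    have h1 : AbsConvAt ((P : ℂ⟦X⟧) ^ K) z := by
      simpa using absConvAt_polynomial (P ^ K) z
    have h2 := (h1.mul (habs z hz)).hasSum
    rw [h1.eval_mul (habs z hz)] at h2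
    convert! h2 using 1
    have h3 : eval ((P : ℂ⟦X⟧) ^ K) z = P.eval z ^ K := by
      simpa using eval_polynomial (P ^ K) z
    rw [h3, eval, (hsum z (hz.trans hR)).tsum_eq, hF, ← mul_pow,
      mul_inv_cancel₀ (hP0 z (hz.trans hR).le), one_pow]
  have hPc : constantCoeff (P : ℂ⟦X⟧) ≠ 0 := by
    have := hP0 0 (by simpa using hR0.le)
    rwa [Polynomial.constantCoeff_coe, Polynomial.coeff_zero_eq_eval_zero]
  have hTeq : (P : ℂ⟦X⟧)⁻¹ ^ K = T := by
    calc (P : ℂ⟦X⟧)⁻¹ ^ K = (P : ℂ⟦X⟧)⁻¹ ^ K * ((P : ℂ⟦X⟧) ^ K * T) := by rw [hmul, mul_one]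
      _ = T := by rw [← mul_assoc, ← mul_pow, PowerSeries.inv_mul_cancel _ hPc, one_pow, one_mul]
  rw [hTeq, ← ENNReal.tsum_geometric, ← ENNReal.tsum_mul_left]
  refine ENNReal.tsum_le_tsum fun n => ?_
  rw [← ofReal_norm, ← ENNReal.ofReal_pow (by positivity), ← ENNReal.ofReal_pow (by positivity),
    ← ENNReal.ofReal_mul (by positivity)]
  exact ENNReal.ofReal_le_ofReal (hbound n)

/-- The coefficientwise sum of a sequence of power series; it is used when the sum of their Wiener
norms is finite. -/
def tsumSeries (G : ℕ → ℂ⟦X⟧) : ℂ⟦X⟧ := PowerSeries.mk fun n => ∑' j, coeff n (G j)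

theorem summable_coeff {G : ℕ → ℂ⟦X⟧} (hG : ∑' j, wienerNorm (G j) ≠ ⊤) (n : ℕ) :
    Summable fun j => coeff n (G j) := by
  refine Summable.of_norm ?_
  have h1 : ∑' j, ‖coeff n (G j)‖ₑ ≠ ⊤ :=
    ne_top_of_le_ne_top hG (ENNReal.tsum_le_tsum fun j => enorm_coeff_le_wienerNorm _ _)
  simpa using ENNReal.summable_toReal h1

theorem wienerNorm_tsumSeries_le (G : ℕ → ℂ⟦X⟧) :
    wienerNorm (tsumSeries G) ≤ ∑' j, wienerNorm (G j) := by
  simp only [wienerNorm, tsumSeries, coeff_mk]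
  rw [ENNReal.tsum_comm]
  exact ENNReal.tsum_le_tsum fun n => enorm_tsum_le_tsum_enorm

theorem mul_tsumSeries (f : ℂ⟦X⟧) {G : ℕ → ℂ⟦X⟧} (hG : ∑' j, wienerNorm (G j) ≠ ⊤) :
    f * tsumSeries G = tsumSeries fun j => f * G j := by
  ext n
  simp only [tsumSeries, coeff_mul, coeff_mk]
  have h1 : ∀ p ∈ Finset.HasAntidiagonal.antidiagonal n,
      Summable fun j => coeff p.1 f * coeff p.2 (G j) :=
    fun p _ => Summable.mul_left _ (summable_coeff hG p.2)
  rw [Summable.tsum_finsetSum h1]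
  exact Finset.sum_congr rfl fun p _ => (tsum_mul_left).symm

theorem tsumSeries_eq_zero_add {G : ℕ → ℂ⟦X⟧} (hG : ∑' j, wienerNorm (G j) ≠ ⊤) :
    tsumSeries G = G 0 + tsumSeries fun j => G (j + 1) := by
  ext n
  simp only [tsumSeries, map_add, coeff_mk]
  exact (summable_coeff hG n).tsum_eq_zero_add

/-- Neumann series. -/
theorem wienerNorm_inv_one_sub {f : ℂ⟦X⟧} (hf : wienerNorm f < 1) :
    wienerNorm (1 - f)⁻¹ ≠ ⊤ := by
  have hc : constantCoeff (1 - f) ≠ 0 := by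
    intro h
    have h1 : constantCoeff f = 1 := by
      rw [map_sub, map_one] at h
      exact (sub_eq_zero.mp h).symm
    have h2 := enorm_coeff_le_wienerNorm f 0
    rw [coeff_zero_eq_constantCoeff_apply, h1, enorm_one] at h2
    exact absurd hf (not_lt.mpr h2)
  have hle : ∀ k, wienerNorm (f ^ k) ≤ wienerNorm f ^ k := wienerNorm_pow_le f
  have hsum : ∑' k, wienerNorm (f ^ k) ≠ ⊤ := by
    refine ne_top_of_le_ne_top ?_ (ENNReal.tsum_le_tsum hle)
    rw [ENNReal.tsum_geometric]
    exact ENNReal.inv_ne_top.mpr (tsub_pos_of_lt hf).ne'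
  have hmul : (1 - f) * tsumSeries (fun k => f ^ k) = 1 := by
    have h1 := tsumSeries_eq_zero_add hsum
    rw [sub_mul, one_mul, mul_tsumSeries _ hsum]
    simp only [pow_succ', pow_zero] at h1
    linear_combination h1
  have hinv : (1 - f)⁻¹ = tsumSeries (fun k => f ^ k) := by
    rw [PowerSeries.inv_eq_iff_mul_eq_one hc, mul_comm, hmul]
  rw [hinv]
  exact ne_top_of_le_ne_top hsum (wienerNorm_tsumSeries_le _)

theorem wienerNorm_sub_trunc (f : ℂ⟦X⟧) (N : ℕ) :
    wienerNorm (f - (trunc N f : Polynomial ℂ)) = ∑' n, ‖coeff (n + N) f‖ₑ := by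
  rw [wienerNorm, ← Summable.sum_add_tsum_nat_add' (k := N) ENNReal.summable,
    Finset.sum_eq_zero, zero_add]
  · refine tsum_congr fun n => ?_
    rw [map_sub, Polynomial.coeff_coe, coeff_trunc, if_neg (by omega), sub_zero]
  · intro n hn
    rw [map_sub, Polynomial.coeff_coe, coeff_trunc, if_pos (Finset.mem_range.mp hn), sub_self,
      enorm_zero]

/-- **Wiener's lemma** on the closed disc: an absolutely convergent power series without zeros
there has an absolutely convergent inverse. The proof is Newman's: with a truncation `P` close to
`f`, `f P⁻¹ = 1 - e` where `e = (P - f) P⁻¹` has a power of norm less than `1`. -/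
theorem wienerNorm_inv_ne_top {f : ℂ⟦X⟧} (hf : wienerNorm f ≠ ⊤)
    (h0 : ∀ z : ℂ, ‖z‖ ≤ 1 → eval f z ≠ 0) : wienerNorm f⁻¹ ≠ ⊤ := by
  obtain ⟨z₀, hz₀, hmin⟩ := (isCompact_closedBall (0 : ℂ) 1).exists_isMinOn
    ⟨0, by simp⟩ (continuousOn_eval hf).norm
  obtain ⟨m, hm, hmf⟩ : ∃ m : ℝ, 0 < m ∧ ∀ z : ℂ, ‖z‖ ≤ 1 → m ≤ ‖eval f z‖ :=
    ⟨_, norm_pos_iff.mpr (h0 z₀ (mem_closedBall_zero_iff.mp hz₀)),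
      fun z hz => hmin (mem_closedBall_zero_iff.mpr hz)⟩
  obtain ⟨N, hN⟩ : ∃ N, wienerNorm (f - (trunc N f : Polynomial ℂ)) ≤ ENNReal.ofReal (m / 4) := by
    have h1 : Tendsto (fun N => ∑' n, ‖coeff (n + N) f‖ₑ) atTop (𝓝 0) :=
      ENNReal.tendsto_sum_nat_add _ hf
    obtain ⟨N, hN⟩ := (h1.eventually_le_const
      (ENNReal.ofReal_pos.mpr (by positivity : 0 < m / 4))).exists
    exact ⟨N, by rwa [wienerNorm_sub_trunc]⟩
  set P : Polynomial ℂ := trunc N f with hP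
  have hPlow : ∀ z : ℂ, ‖z‖ ≤ 1 → m / 2 < ‖P.eval z‖ := by
    intro z hz
    have h1 := (enorm_eval_le (f - (P : ℂ⟦X⟧)) hz).trans hN
    rw [← ofReal_norm, ENNReal.ofReal_le_ofReal_iff (by positivity)] at h1
    have h2 : eval f z = eval (f - (P : ℂ⟦X⟧)) z + P.eval z := by
      rw [← eval_polynomial, ← AbsConvAt.eval_add _ (absConvAt_polynomial P z), sub_add_cancel]
      exact absConvAt_of_wienerNorm (ne_top_of_le_ne_top ENNReal.ofReal_ne_top hN) hz
    have h3 := hmf z hz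
    rw [h2] at h3
    have h4 := norm_add_le (eval (f - (P : ℂ⟦X⟧)) z) (P.eval z)
    linarith
  -- the lower bound persists on a larger disc
  obtain ⟨R, hR, hPR⟩ : ∃ R : ℝ, 1 < R ∧ ∀ z : ℂ, ‖z‖ ≤ R → m / 2 ≤ ‖P.eval z‖ := by
    have hopen : IsOpen {z : ℂ | m / 2 < ‖P.eval z‖} :=
      isOpen_lt continuous_const P.continuous.norm
    obtain ⟨ε, hε, hsub⟩ := (isCompact_closedBall (0 : ℂ) 1).exists_cthickening_subset_open hopen
      fun z hz => hPlow z (mem_closedBall_zero_iff.mp hz)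
    rw [cthickening_closedBall hε.le zero_le_one] at hsub
    exact ⟨ε + 1, by linarith, fun z hz => (hsub (mem_closedBall_zero_iff.mpr hz)).le⟩
  have hinv := wienerNorm_inv_polynomial_pow_le hR (half_pos hm) hPR
  set A := (1 - ENNReal.ofReal R⁻¹)⁻¹ with hA
  have hAtop : A ≠ ⊤ := by
    rw [hA, ENNReal.inv_ne_top, ← ENNReal.ofReal_one, ← ENNReal.ofReal_sub _ (by positivity)]
    have := inv_lt_one_of_one_lt₀ hR
    exact (ENNReal.ofReal_pos.mpr (by linarith)).ne'
  have hPc : constantCoeff (P : ℂ⟦X⟧) ≠ 0 := by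
    have := hPlow 0 (by simp)
    rw [Polynomial.constantCoeff_coe, Polynomial.coeff_zero_eq_eval_zero, ← norm_pos_iff]
    linarith
  set g : ℂ⟦X⟧ := (P : ℂ⟦X⟧)⁻¹ with hg
  have hPg : (P : ℂ⟦X⟧) * g = 1 := PowerSeries.mul_inv_cancel _ hPc
  set e : ℂ⟦X⟧ := (P - f) * g with he
  have hfe : f * g = 1 - e := by linear_combination hPg
  have heK : ∀ K, wienerNorm (e ^ K) ≤ ENNReal.ofReal (1 / 2) ^ K * A := by
    intro K
    have h1 : wienerNorm ((P : ℂ⟦X⟧) - f) ≤ ENNReal.ofReal (m / 4) := by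
      rwa [← wienerNorm_neg, neg_sub]
    calc wienerNorm (e ^ K) ≤ wienerNorm (P - f) ^ K * wienerNorm (g ^ K) := by
          rw [he, mul_pow]
          exact (wienerNorm_mul_le _ _).trans (by gcongr; exact wienerNorm_pow_le _ _)
      _ ≤ ENNReal.ofReal (m / 4) ^ K * (ENNReal.ofReal (m / 2)⁻¹ ^ K * A) := by
          gcongr
          exact hinv K
      _ = ENNReal.ofReal (1 / 2) ^ K * A := by
          rw [← mul_assoc, ← mul_pow, ← ENNReal.ofReal_mul (by positivity)]
          congr 3
          field_simp
          norm_num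
  -- the rate `m / 4` of `P - f` beats the rate `2 / m` of `P⁻¹`
  obtain ⟨K, hK⟩ : ∃ K, wienerNorm (e ^ K) < 1 := by
    have h1 : Tendsto (fun K => ENNReal.ofReal (1 / 2) ^ K * A) atTop (𝓝 (0 * A)) :=
      ENNReal.Tendsto.mul_const (ENNReal.tendsto_pow_atTop_nhds_zero_of_lt_one
        (ENNReal.ofReal_lt_one.mpr (by norm_num))) (Or.inr hAtop)
    rw [zero_mul] at h1
    obtain ⟨K, hK⟩ := (h1.eventually_lt_const zero_lt_one).exists
    exact ⟨K, (heK K).trans_lt hK⟩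
  have hgtop : wienerNorm g ≠ ⊤ := by
    have := hinv 1
    rw [pow_one, pow_one] at this
    exact ne_top_of_le_ne_top (ENNReal.mul_ne_top ENNReal.ofReal_ne_top hAtop) this
  have hsumtop : wienerNorm (∑ k ∈ Finset.range K, e ^ k) ≠ ⊤ := by
    refine ne_top_of_le_ne_top ?_ (wienerNorm_sum_le _ _)
    exact ENNReal.sum_ne_top.mpr fun k _ => ne_top_of_le_ne_top
      (ENNReal.mul_ne_top (ENNReal.pow_ne_top ENNReal.ofReal_ne_top) hAtop) (heK k)
  have hc : constantCoeff (1 - e ^ K) ≠ 0 := by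
    intro h
    have h2 := enorm_coeff_le_wienerNorm (e ^ K) 0
    rw [map_sub, map_one, sub_eq_zero] at h
    rw [coeff_zero_eq_constantCoeff_apply, ← h, enorm_one] at h2
    exact absurd hK (not_lt.mpr h2)
  have hfc : constantCoeff f ≠ 0 := by
    intro h
    have h1 := congrArg constantCoeff (mul_geom_sum e K)
    have h2 := congrArg constantCoeff hfe
    rw [map_mul, h, zero_mul, map_sub, map_one] at h2
    rw [map_mul, map_sub, map_one, ← neg_sub, ← h2, neg_zero, zero_mul] at h1
    apply hc
    rw [← neg_sub, map_neg, ← h1, neg_zero]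
  have hfinv : f⁻¹ = g * (∑ k ∈ Finset.range K, e ^ k) * (1 - e ^ K)⁻¹ := by
    rw [PowerSeries.inv_eq_iff_mul_eq_one hfc]
    have h1 := PowerSeries.mul_inv_cancel _ hc
    linear_combination h1 + (∑ k ∈ Finset.range K, e ^ k) * (1 - e ^ K)⁻¹ * hfe
      - (1 - e ^ K)⁻¹ * mul_geom_sum e K
  rw [hfinv]
  refine ne_top_of_le_ne_top ?_ (wienerNorm_mul_le _ _)
  refine ENNReal.mul_ne_top (ne_top_of_le_ne_top ?_ (wienerNorm_mul_le _ _))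
    (wienerNorm_inv_one_sub hK)
  exact ENNReal.mul_ne_top hgtop hsumtop

/-! ### The powers of `1 - X` -/

/-- The coefficient of `X ^ n` in `(1 - X) ^ α`. -/
def subCoeff (α : ℝ) (n : ℕ) : ℝ := (-1) ^ n * Ring.choose α n

/-- The formal power series `(1 - X) ^ α`. -/
def oneSubPow (α : ℝ) : ℂ⟦X⟧ := PowerSeries.mk fun n => (subCoeff α n : ℂ)

@[simp] theorem coeff_oneSubPow (α : ℝ) (n : ℕ) : coeff n (oneSubPow α) = (subCoeff α n : ℂ) :=
  coeff_mk _ _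

@[simp] theorem subCoeff_zero (α : ℝ) : subCoeff α 0 = 1 := by simp [subCoeff]

theorem succ_mul_choose_succ (α : ℝ) (n : ℕ) :
    ((n : ℝ) + 1) * Ring.choose α (n + 1) = (α - n) * Ring.choose α n := by
  simp only [Ring.choose_eq_smul, descPochhammer_succ_right, Polynomial.smeval_mul,
    Polynomial.smeval_sub, Polynomial.smeval_X, Polynomial.smeval_natCast, Nat.factorial_succ,
    Nat.cast_mul, smul_eq_mul, nsmul_eq_mul, pow_one, pow_zero, mul_one]
  push_cast
  field_simp

theorem subCoeff_succ (α : ℝ) (n : ℕ) :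
    ((n : ℝ) + 1) * subCoeff α (n + 1) = (n - α) * subCoeff α n := by
  have := succ_mul_choose_succ α n
  simp only [subCoeff, pow_succ]
  linear_combination (-(-1) ^ n) * this

theorem sum_subCoeff_mul (α γ : ℝ) (n : ℕ) :
    ∑ p ∈ Finset.HasAntidiagonal.antidiagonal n, subCoeff α p.1 * subCoeff γ p.2
      = subCoeff (α + γ) n := by
  rw [subCoeff, Ring.add_choose_eq n (Commute.all α γ), Finset.mul_sum]
  refine Finset.sum_congr rfl fun p hp => ?_
  rw [← Finset.HasAntidiagonal.mem_antidiagonal.mp hp, pow_add, subCoeff, subCoeff]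
  ring

theorem oneSubPow_mul (α γ : ℝ) : oneSubPow α * oneSubPow γ = oneSubPow (α + γ) := by
  ext n
  rw [coeff_mul, coeff_oneSubPow, ← sum_subCoeff_mul]
  simp

theorem oneSubPow_zero : oneSubPow 0 = 1 := by
  ext n
  rcases n with _ | n
  · simp
  · simp [subCoeff, Ring.choose_zero_succ]

theorem oneSubPow_one : oneSubPow 1 = 1 - X := by
  ext n
  rcases n with _ | _ | n
  · simp
  · simp [subCoeff, coeff_X, coeff_one]
  · have h : Ring.choose (1 : ℝ) (n + 2) = 0 := by
      have := Ring.choose_natCast (R := ℝ) 1 (n + 2)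
      rw [Nat.cast_one, Nat.choose_eq_zero_of_lt (by omega)] at this
      simpa using this
    simp [subCoeff, coeff_X, coeff_one, h]

theorem one_sub_X_mul_oneSubPow (α : ℝ) : (1 - X) * oneSubPow α = oneSubPow (α + 1) := by
  rw [← oneSubPow_one, oneSubPow_mul, add_comm]

theorem coeff_succ_one_sub_X_mul (f : ℂ⟦X⟧) (n : ℕ) :
    coeff (n + 1) ((1 - X) * f) = coeff (n + 1) f - coeff n f := by
  rw [sub_mul, one_mul, map_sub, coeff_succ_X_mul]

theorem subCoeff_add_one_succ (α : ℝ) (n : ℕ) :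
    subCoeff (α + 1) (n + 1) = subCoeff α (n + 1) - subCoeff α n := by
  have h := coeff_succ_one_sub_X_mul (oneSubPow α) n
  rw [one_sub_X_mul_oneSubPow] at h
  simp only [coeff_oneSubPow] at h
  exact_mod_cast h

/-- The coefficients of `(1 - X) ^ α` are the partial sums of those of `(1 - X) ^ (α + 1)`. -/
theorem sum_range_subCoeff (α : ℝ) (n : ℕ) :
    ∑ i ∈ Finset.range (n + 1), subCoeff (α + 1) i = subCoeff α n := by
  induction n with
  | zero => simp
  | succ n ih => rw [Finset.sum_range_succ, ih, subCoeff_add_one_succ]; ring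

theorem subCoeff_pos {α : ℝ} (hα : α < 0) (n : ℕ) : 0 < subCoeff α n := by
  induction n with
  | zero => simp
  | succ n ih =>
    have h := subCoeff_succ α n
    have h1 : 0 < ((n : ℝ) - α) * subCoeff α n :=
      mul_pos (by have := Nat.cast_nonneg (α := ℝ) n; linarith) ih
    rw [← h] at h1
    exact pos_of_mul_pos_right h1 (by positivity)

theorem subCoeff_succ_nonpos {α : ℝ} (h0 : 0 ≤ α) (h1 : α ≤ 1) (n : ℕ) :
    subCoeff α (n + 1) ≤ 0 := by
  induction n with
  | zero =>
    have h := subCoeff_succ α 0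
    simp at h
    simp [h, h0]
  | succ n ih =>
    have h := subCoeff_succ α (n + 1)
    push_cast at h
    have h2 : ((n : ℝ) + 1 - α) * subCoeff α (n + 1) ≤ 0 :=
      mul_nonpos_of_nonneg_of_nonpos
        (by have := Nat.cast_nonneg (α := ℝ) n; linarith) ih
    rw [← h] at h2
    exact nonpos_of_mul_nonpos_right h2 (by positivity)

/-- All coefficients but the first are nonpositive, and the partial sums, being coefficients of
`(1 - X) ^ (α - 1)`, are positive; so the absolute values sum to at most `2`. -/
theorem summable_abs_subCoeff {α : ℝ} (h0 : 0 ≤ α) (h1 : α < 1) :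
    Summable fun n => |subCoeff α n| := by
  rw [← summable_nat_add_iff 1]
  refine summable_of_sum_range_le (c := 1) (fun _ => abs_nonneg _) fun n => ?_
  have h2 : ∑ i ∈ Finset.range n, |subCoeff α (i + 1)|
      = -∑ i ∈ Finset.range n, subCoeff α (i + 1) := by
    rw [← Finset.sum_neg_distrib]
    exact Finset.sum_congr rfl fun i _ => abs_of_nonpos (subCoeff_succ_nonpos h0 h1.le i)
  have h3 := sum_range_subCoeff (α - 1) n
  rw [sub_add_cancel, Finset.sum_range_succ', subCoeff_zero] at h3
  have h4 := subCoeff_pos (show α - 1 < 0 by linarith) n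
  linarith

theorem wienerNorm_oneSubPow_ne_top {α : ℝ} (h0 : 0 ≤ α) (h1 : α < 1) :
    wienerNorm (oneSubPow α) ≠ ⊤ :=
  wienerNorm_ne_top_of_summable (by simpa using summable_abs_subCoeff h0 h1)

theorem hasSum_oneSubPow (α : ℝ) {z : ℂ} (hz : ‖z‖ < 1) :
    HasSum (fun n => coeff n (oneSubPow α) * z ^ n) ((1 - z) ^ (α : ℂ)) := by
  have h := (Complex.one_add_cpow_hasFPowerSeriesOnBall_zero (a := (α : ℂ))).hasSum (y := -z)
    (by simpa [enorm_eq_nnnorm, ← NNReal.coe_lt_coe] using hz)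
  rw [zero_add, ← sub_eq_add_neg] at h
  convert! h using 2 with n
  rw [coeff_oneSubPow, subCoeff]
  simp only [binomialSeries_apply, smul_eq_mul, List.ofFn_const, List.prod_replicate, neg_pow z]
  push_cast [Complex.ofReal_choose]
  ring

/-- Euler's limit formula for the Gamma function, in terms of the coefficients of `(1 - X) ^ (-p -
1)`. -/
theorem tendsto_rpow_div_subCoeff {p : ℝ} (hp : -1 < p) :
    Tendsto (fun n : ℕ => (n : ℝ) ^ p / subCoeff (-p - 1) n) atTop (𝓝 (Real.Gamma (p + 1))) := by
  have hprod : ∀ n : ℕ, ∏ j ∈ Finset.range n, (p + 1 + j) = n.factorial * subCoeff (-p - 1) n := by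
    intro n
    induction n with
    | zero => simp
    | succ n ih =>
      rw [Finset.prod_range_succ, ih, Nat.factorial_succ]
      push_cast
      linear_combination (-(n.factorial : ℝ)) * subCoeff_succ (-p - 1) n
  have h1 := Real.GammaSeq_tendsto_Gamma (p + 1)
  have h2 : Tendsto (fun n : ℕ => 1 + (p + 1) / (n : ℝ)) atTop (𝓝 (1 + 0)) :=
    tendsto_const_nhds.add (tendsto_const_div_atTop_nhds_zero_nat _)
  have h3 := h1.mul h2
  rw [add_zero, mul_one] at h3
  refine h3.congr' ?_
  filter_upwards [eventually_ge_atTop 1] with n hn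
  have hn0 : (0 : ℝ) < n := by exact_mod_cast hn
  have hc := subCoeff_pos (show -p - 1 < 0 by linarith) n
  have hpn : 0 < p + 1 + n := by linarith
  rw [Real.GammaSeq, Finset.prod_range_succ, hprod, Real.rpow_add hn0, Real.rpow_one]
  field_simp
  ring

/-! ### Boundary values, and the powers of `(1 + X) / 2` -/

theorem eval_tsumSeries {G : ℕ → ℂ⟦X⟧} (hG : ∑' j, wienerNorm (G j) ≠ ⊤) {z : ℂ} (hz : ‖z‖ ≤ 1) :
    eval (tsumSeries G) z = ∑' j, eval (G j) z := by
  have hs : Summable (Function.uncurry fun (n j : ℕ) => coeff n (G j) * z ^ n) := by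
    refine Summable.of_norm ?_
    have h1 : ∑' p : ℕ × ℕ, ‖coeff p.1 (G p.2)‖ₑ ≠ ⊤ := by
      rw [ENNReal.tsum_prod', ENNReal.tsum_comm]
      exact hG
    have h2 := ENNReal.summable_toReal h1
    refine Summable.of_nonneg_of_le (fun _ => norm_nonneg _) (fun p => ?_) h2
    rw [Function.uncurry, norm_mul, norm_pow, toReal_enorm]
    exact mul_le_of_le_one_right (norm_nonneg _) (pow_le_one₀ (norm_nonneg _) hz)
  simp only [eval, tsumSeries, coeff_mk]
  refine Eq.trans ?_ hs.tsum_comm.symm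
  exact tsum_congr fun n => (tsum_mul_right).symm

theorem closedBall_subset_closure_ball : Metric.closedBall (0 : ℂ) 1 ⊆
    closure (Metric.ball (0 : ℂ) 1) := by
  rw [closure_ball _ one_ne_zero]

theorem re_le_one {z : ℂ} (hz : ‖z‖ ≤ 1) : z.re ≤ 1 := (Complex.re_le_norm z).trans hz

/-- By continuity, the binomial series represents `(1 - z) ^ β` on the closed disc, `z = 1`
included. -/
theorem eval_oneSubPow {β : ℝ} (h0 : 0 < β) (h1 : β < 1) {z : ℂ} (hz : ‖z‖ ≤ 1) :
    eval (oneSubPow β) z = (1 - z) ^ (β : ℂ) := by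
  have h : Set.EqOn (eval (oneSubPow β)) (fun z => (1 - z) ^ (β : ℂ)) (Metric.closedBall 0 1) := by
    refine Set.EqOn.of_subset_closure (s := Metric.ball 0 1) (fun z hz => ?_)
      (continuousOn_eval (wienerNorm_oneSubPow_ne_top h0.le h1)) (fun z hz => ?_)
      Metric.ball_subset_closedBall closedBall_subset_closure_ball
    · exact (hasSum_oneSubPow β (mem_ball_zero_iff.mp hz)).tsum_eq
    · have hre := re_le_one (mem_closedBall_zero_iff.mp hz)
      have h2 : ContinuousAt (fun x : ℂ => x ^ (β : ℂ)) (1 - z) :=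
        Complex.continuousAt_cpow_const_of_re_pos (Or.inl (by simpa using hre)) (by simpa using h0)
      exact (ContinuousAt.comp (f := fun z : ℂ => 1 - z) h2
        (by fun_prop)).continuousWithinAt
  exact h (mem_closedBall_zero_iff.mpr hz)

/-- The polynomial `(1 - X) / 2`. Its Wiener norm is `1`, so that power series with absolutely
summable coefficients can be evaluated at it. -/
def halfSub : ℂ⟦X⟧ := C (1 / 2) * (1 - X)

theorem wienerNorm_halfSub_le : wienerNorm halfSub ≤ 1 := by
  have h1 : wienerNorm (1 - X : ℂ⟦X⟧) ≤ 2 := by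
    rw [sub_eq_add_neg]
    refine (wienerNorm_add_le _ _).trans ?_
    rw [wienerNorm_neg, wienerNorm_one, wienerNorm_X, one_add_one_eq_two]
  calc wienerNorm halfSub ≤ ‖(1 / 2 : ℂ)‖ₑ * 2 := by
        refine (wienerNorm_mul_le _ _).trans ?_
        rw [wienerNorm_C]
        gcongr
    _ = 1 := by
        rw [← ofReal_norm, show (2 : ℝ≥0∞) = ENNReal.ofReal 2 by simp,
          ← ENNReal.ofReal_mul (norm_nonneg _)]
        norm_num

theorem eval_C_mul_halfSub_pow (c : ℂ) (j : ℕ) (z : ℂ) :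
    eval (C c * halfSub ^ j) z = c * ((1 - z) / 2) ^ j := by
  have h := eval_polynomial
    (Polynomial.C c * (Polynomial.C (1 / 2) * (1 - Polynomial.X)) ^ j) z
  simp only [Polynomial.coe_mul, Polynomial.coe_pow, Polynomial.coe_sub, Polynomial.coe_C,
    Polynomial.coe_X, Polynomial.coe_one, Polynomial.eval_mul, Polynomial.eval_pow,
    Polynomial.eval_sub, Polynomial.eval_C, Polynomial.eval_X, Polynomial.eval_one] at h
  rw [halfSub, h]
  ring

/-- The power series `((1 + X) / 2) ^ β`, obtained by substituting `(1 - X) / 2` for `Y` in `(1 -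
Y) ^ β` (an Euler transform). In this form it can be divided by powers of `1 - X`. -/
def halfAddPow (β : ℝ) : ℂ⟦X⟧ := tsumSeries fun j => C (subCoeff β j : ℂ) * halfSub ^ j

theorem wienerNorm_C_mul_halfSub_pow_le (c : ℂ) (j : ℕ) :
    wienerNorm (C c * halfSub ^ j) ≤ ‖c‖ₑ := by
  refine (wienerNorm_mul_le _ _).trans ?_
  rw [wienerNorm_C]
  refine mul_le_of_le_one_right' ((wienerNorm_pow_le _ _).trans ?_)
  exact pow_le_one' wienerNorm_halfSub_le j

/-- The shift `i` serves the tails of the series that defines `halfAddPow`. -/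
theorem tsum_wienerNorm_binomial_ne_top {β : ℝ} (h0 : 0 ≤ β) (h1 : β < 1) (i : ℕ) :
    ∑' j, wienerNorm (C (subCoeff β (j + i) : ℂ) * halfSub ^ j) ≠ ⊤ := by
  have h2 := wienerNorm_oneSubPow_ne_top h0 h1
  have h3 : ∑' j, ‖coeff (j + i) (oneSubPow β)‖ₑ ≤ wienerNorm (oneSubPow β) := by
    exact ENNReal.tsum_comp_le_tsum_of_injective (add_left_injective i)
      fun n => ‖coeff n (oneSubPow β)‖ₑ
  refine ne_top_of_le_ne_top h2 (le_trans (ENNReal.tsum_le_tsum fun j => ?_) h3)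
  rw [coeff_oneSubPow]
  exact wienerNorm_C_mul_halfSub_pow_le _ _

theorem wienerNorm_halfAddPow_ne_top {β : ℝ} (h0 : 0 ≤ β) (h1 : β < 1) :
    wienerNorm (halfAddPow β) ≠ ⊤ :=
  ne_top_of_le_ne_top (tsum_wienerNorm_binomial_ne_top h0 h1 0) (wienerNorm_tsumSeries_le _)

theorem eval_halfAddPow {β : ℝ} (h0 : 0 < β) (h1 : β < 1) {z : ℂ} (hz : ‖z‖ ≤ 1) :
    eval (halfAddPow β) z = ((1 + z) / 2) ^ (β : ℂ) := by
  have hw : ‖(1 - z) / 2‖ ≤ 1 := by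
    rw [norm_div, Complex.norm_ofNat, div_le_one two_pos]
    have := norm_sub_le 1 z
    rw [norm_one] at this
    linarith
  rw [halfAddPow]
  refine (eval_tsumSeries (tsum_wienerNorm_binomial_ne_top h0.le h1 0) hz).trans ?_
  simp only [eval_C_mul_halfSub_pow]
  have h2 := eval_oneSubPow h0 h1 hw
  rw [show 1 - (1 - z) / 2 = (1 + z) / 2 by ring] at h2
  rw [← h2, eval]
  simp

/-- The Taylor expansion of `((1 + X) / 2) ^ β` at `X = 1` to second order, with an `ℓ¹`
remainder. -/
theorem exists_halfAddPow_eq {β : ℝ} (h0 : 0 ≤ β) (h1 : β < 1) :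
    ∃ q : ℂ⟦X⟧, wienerNorm q ≠ ⊤ ∧
      halfAddPow β = 1 - C (β / 2 : ℂ) * (1 - X) + (1 - X) ^ 2 * q := by
  set q' : ℂ⟦X⟧ := tsumSeries fun j => C (subCoeff β (j + 2) : ℂ) * halfSub ^ j with hq'
  refine ⟨C (1 / 4) * q', ?_, ?_⟩
  · refine ne_top_of_le_ne_top (ENNReal.mul_ne_top ?_ ?_) (wienerNorm_mul_le _ _)
    · rw [wienerNorm_C]; exact enorm_ne_top
    · exact ne_top_of_le_ne_top (tsum_wienerNorm_binomial_ne_top h0 h1 2)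
        (wienerNorm_tsumSeries_le _)
  · have hstep : ∀ i, tsumSeries (fun j => C (subCoeff β (j + i) : ℂ) * halfSub ^ j)
        = C (subCoeff β i : ℂ)
          + halfSub * tsumSeries (fun j => C (subCoeff β (j + (i + 1)) : ℂ) * halfSub ^ j) := by
      intro i
      rw [tsumSeries_eq_zero_add (tsum_wienerNorm_binomial_ne_top h0 h1 i),
        mul_tsumSeries _ (tsum_wienerNorm_binomial_ne_top h0 h1 (i + 1))]
      congr 1
      · simp
      · congr 1
        funext j
        rw [show j + 1 + i = j + (i + 1) by ring, pow_succ]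
        ring
    have hs1 : subCoeff β 1 = -β := by
      have := subCoeff_succ β 0
      simpa using this
    have e0 := hstep 0
    have e1 := hstep 1
    rw [← hq'] at e1
    rw [zero_add, e1, hs1, subCoeff_zero] at e0
    simp only [add_zero] at e0
    rw [halfAddPow, e0]
    have e3 : (C (β / 2 : ℂ) : ℂ⟦X⟧) = C (β : ℂ) * C (1 / 2) := by
      rw [← map_mul]; congr 1; ring
    have e4 : (C (1 / 4 : ℂ) : ℂ⟦X⟧) = C (1 / 2) * C (1 / 2) := by
      rw [← map_mul]; congr 1; norm_num
    rw [e3, e4, halfSub]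
    push_cast
    simp only [map_one, map_neg]
    ring

/-! ### Size of the binomial coefficients, and fractional differences -/

theorem isBigO_rpow_subCoeff {p : ℝ} (hp : -1 < p) :
    (fun n : ℕ => (n : ℝ) ^ p) =O[atTop] subCoeff (-p - 1) :=
  isBigO_of_div_tendsto_nhds
    (Eventually.of_forall fun n h => absurd h (subCoeff_pos (by linarith) n).ne') _
    (tendsto_rpow_div_subCoeff hp)

theorem isBigO_subCoeff_rpow {p : ℝ} (hp : -1 < p) :
    subCoeff (-p - 1) =O[atTop] fun n : ℕ => (n : ℝ) ^ p := by
  have h := (tendsto_rpow_div_subCoeff hp).inv₀ (Real.Gamma_pos_of_pos (by linarith)).ne'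
  simp only [inv_div] at h
  refine isBigO_of_div_tendsto_nhds ?_ _ h
  filter_upwards [eventually_ge_atTop 1] with n hn h0
  exact absurd h0 (Real.rpow_pos_of_pos (by exact_mod_cast hn) p).ne'

theorem add_mul_subCoeff_neg (p : ℝ) (n : ℕ) :
    ((n : ℝ) + p) * subCoeff (-p) n = p * subCoeff (-p - 1) n := by
  rcases n with _ | n
  · simp
  · have h1 := subCoeff_add_one_succ (-p - 1) n
    have h2 := subCoeff_succ (-p - 1) n
    rw [sub_add_cancel] at h1
    push_cast
    rw [h1]
    linear_combination h2

/-- The bound `O(n ^ p)` for the coefficients of `(1 - X) ^ (-p - 1)` passes from `p` to `p - 1`. -/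
theorem isBigO_subCoeff_neg {p : ℝ}
    (h : subCoeff (-p - 1) =O[atTop] fun n : ℕ => (n : ℝ) ^ p) :
    subCoeff (-p) =O[atTop] fun n : ℕ => (n : ℝ) ^ (p - 1) := by
  have h1 : (fun n : ℕ => p / ((n : ℝ) + p)) =O[atTop] fun n : ℕ => (n : ℝ)⁻¹ := by
    refine isBigO_of_div_tendsto_nhds (c := p) ?_ ?_
    · filter_upwards [eventually_ge_atTop 1] with n hn h0
      have : (n : ℝ) ≠ 0 := by exact_mod_cast (by omega : n ≠ 0)
      simp [this] at h0
    · have h2 : Tendsto (fun n : ℕ => p * (1 + p / (n : ℝ))⁻¹) atTop (𝓝 (p * (1 + 0)⁻¹)) :=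
        ((tendsto_const_nhds.add (tendsto_const_div_atTop_nhds_zero_nat p)).inv₀
          (by norm_num)).const_mul p
      rw [add_zero, inv_one, mul_one] at h2
      refine h2.congr' ?_
      filter_upwards [eventually_ge_atTop 1, eventually_gt_atTop ⌈-p⌉₊] with n hn hn2
      have : (0 : ℝ) < n := by exact_mod_cast hn
      have h3 : 0 < (n : ℝ) + p := by linarith [Nat.lt_of_ceil_lt hn2]
      simp only [Pi.div_apply]
      field_simp
  refine (h1.mul h).congr' ?_ ?_
  · filter_upwards [eventually_gt_atTop ⌈-p⌉₊] with n hn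
    have h3 : 0 < (n : ℝ) + p := by linarith [Nat.lt_of_ceil_lt hn]
    have h4 := add_mul_subCoeff_neg p n
    field_simp
    linarith
  · filter_upwards [eventually_ge_atTop 1] with n hn
    have : (0 : ℝ) < n := by exact_mod_cast hn
    rw [Real.rpow_sub_one this.ne']
    field_simp

/-- The coefficients of `(1 - X) ^ α` are of the order `n ^ (-α - 1)`. Only `-1 < α < 0` needs
this asymptotics; multiplication by `1 - X` preserves null sequences. -/
theorem vanishing_oneSubPow {α : ℝ} (hα : -1 < α) : Vanishing (oneSubPow α) := by
  have base : ∀ α : ℝ, -1 < α → α ≤ 0 → Vanishing (oneSubPow α) := by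
    intro α h1 h2
    rcases h2.lt_or_eq with h2 | rfl
    · have h3 := isBigO_subCoeff_rpow (p := -α - 1) (by linarith)
      rw [show -(-α - 1) - 1 = α by ring] at h3
      have h4 : Tendsto (fun n : ℕ => (n : ℝ) ^ (-α - 1)) atTop (𝓝 0) := by
        have := (tendsto_rpow_neg_atTop (y := α + 1) (by linarith)).comp
          (tendsto_natCast_atTop_atTop (R := ℝ))
        rw [show -α - 1 = -(α + 1) by ring]
        exact this
      have h5 := h3.trans_tendsto h4
      have h6 : Tendsto (fun n => (subCoeff α n : ℂ)) atTop (𝓝 ((0 : ℝ) : ℂ)) :=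
        (Complex.continuous_ofReal.tendsto 0).comp h5
      simpa [Vanishing] using h6
    · rw [oneSubPow_zero]
      exact vanishing_of_wienerNorm (by simp [wienerNorm_one])
  have step : ∀ (k : ℕ) (α : ℝ), -1 < α → α ≤ 0 → Vanishing (oneSubPow (α + k)) := by
    intro k
    induction k with
    | zero => intro α h1 h2; simpa using base α h1 h2
    | succ k ih =>
      intro α h1 h2
      rw [Nat.cast_succ, ← add_assoc, ← one_sub_X_mul_oneSubPow, sub_eq_add_neg]
      refine Vanishing.mul_left (ne_top_of_le_ne_top ?_ (wienerNorm_add_le _ _)) (ih α h1 h2)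
      simp [wienerNorm_neg, wienerNorm_one, wienerNorm_X]
  have h := step ⌈α⌉₊ (α - ⌈α⌉₊)
  rw [sub_add_cancel] at h
  rcases le_or_gt α 0 with h0 | h0
  · exact base α hα h0
  · exact h (by linarith [Nat.ceil_lt_add_one h0.le]) (by linarith [Nat.le_ceil α])

/-- If the differences of a sequence are `O(n ^ (γ - 1))` with `0 < γ < β`, then its fractional
difference of order `β` tends to `0`: the coefficients of `(1 - X) ^ (β - 1)` and `(1 - X) ^ (-γ)`
are positive, so the fractional difference is dominated by the coefficients of `(1 - X) ^ (β - 1 -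
γ)`. -/
theorem vanishing_oneSubPow_mul {β γ : ℝ} (hβ : β < 1) (hγ : 0 < γ) (hγβ : γ < β) {f : ℂ⟦X⟧}
    (hf : (fun n => coeff n ((1 - X) * f)) =O[atTop] fun n : ℕ => (n : ℝ) ^ (γ - 1)) :
    Vanishing (oneSubPow β * f) := by
  have h1 := isBigO_rpow_subCoeff (p := γ - 1) (by linarith)
  rw [show -(γ - 1) - 1 = -γ by ring] at h1
  obtain ⟨M, hM, hb⟩ := bound_of_isBigO_nat_atTop (hf.trans h1)
  have hb' : ∀ n, ‖coeff n ((1 - X) * f)‖ ≤ M * subCoeff (-γ) n := fun n => by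
    have hpos := subCoeff_pos (show -γ < 0 by linarith) n
    simpa [abs_of_pos hpos] using hb hpos.ne'
  have h2 : oneSubPow β * f = oneSubPow (β - 1) * ((1 - X) * f) := by
    rw [← oneSubPow_one, ← mul_assoc, oneSubPow_mul, sub_add_cancel]
  have h3 : Tendsto (fun n => M * subCoeff (β - 1 - γ) n) atTop (𝓝 (M * 0)) := by
    have h4 := (vanishing_oneSubPow (show -1 < β - 1 - γ by linarith)).norm
    have h5 : ∀ n, ‖coeff n (oneSubPow (β - 1 - γ))‖ = subCoeff (β - 1 - γ) n := fun n => by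
      rw [coeff_oneSubPow, Complex.norm_real, Real.norm_of_nonneg]
      exact (subCoeff_pos (by linarith) n).le
    simp only [h5, norm_zero] at h4
    exact h4.const_mul M
  rw [mul_zero] at h3
  rw [Vanishing, h2]
  refine squeeze_zero_norm (fun n => ?_) h3
  rw [coeff_mul]
  calc ‖∑ p ∈ Finset.HasAntidiagonal.antidiagonal n,
        coeff p.1 (oneSubPow (β - 1)) * coeff p.2 ((1 - X) * f)‖
      ≤ ∑ p ∈ Finset.HasAntidiagonal.antidiagonal n,
        subCoeff (β - 1) p.1 * (M * subCoeff (-γ) p.2) := by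
        refine (norm_sum_le _ _).trans (Finset.sum_le_sum fun p _ => ?_)
        have hpos := subCoeff_pos (show β - 1 < 0 by linarith) p.1
        rw [norm_mul, coeff_oneSubPow, Complex.norm_real, Real.norm_of_nonneg hpos.le]
        exact mul_le_mul_of_nonneg_left (hb' _) hpos.le
    _ = M * subCoeff (β - 1 - γ) n := by
        rw [sub_eq_add_neg (β - 1), ← sum_subCoeff_mul, Finset.mul_sum]
        exact Finset.sum_congr rfl fun p _ => by ring

/-- A null sequence with increments `O(n ^ (-3))` is `O(n ^ (-2))`. -/
theorem abs_le_of_abs_sub_le {s : ℕ → ℝ} (hs : Tendsto s atTop (𝓝 0)) {c : ℝ} {n₀ : ℕ}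
    (hn₀ : 1 ≤ n₀) (hc : 0 ≤ c) (h : ∀ n, n₀ ≤ n → |s (n + 1) - s n| ≤ c / ((n : ℝ) + 1) ^ 3)
    {n : ℕ} (hn : n₀ ≤ n) : |s n| ≤ c / (n : ℝ) ^ 2 := by
  have hk : ∀ k : ℕ, |s (n + k) - s n| ≤ c / (n : ℝ) ^ 2 - c / ((n + k : ℕ) : ℝ) ^ 2 := by
    intro k
    induction k with
    | zero => simp
    | succ k ih =>
      have h1 := h (n + k) (by omega)
      have h2 : c / (((n + k : ℕ) : ℝ) + 1) ^ 3
          ≤ c / ((n + k : ℕ) : ℝ) ^ 2 - c / ((n + (k + 1) : ℕ) : ℝ) ^ 2 := by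
        rw [show ((n + (k + 1) : ℕ) : ℝ) = ((n + k : ℕ) : ℝ) + 1 by push_cast; ring]
        have hm : (1 : ℝ) ≤ ((n + k : ℕ) : ℝ) := by exact_mod_cast (by omega : 1 ≤ n + k)
        generalize ((n + k : ℕ) : ℝ) = m at hm
        have hm0 : 0 < m := by linarith
        rw [div_sub_div _ _ (by positivity) (by positivity), div_le_div_iff₀ (by positivity)
          (by positivity)]
        have e : (c * (m + 1) ^ 2 - m ^ 2 * c) * (m + 1) ^ 3 - c * (m ^ 2 * (m + 1) ^ 2)
            = c * ((m + 1) ^ 2 * ((2 * m + 1) * (m + 1) - m ^ 2)) := by ring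
        have : 0 ≤ c * ((m + 1) ^ 2 * ((2 * m + 1) * (m + 1) - m ^ 2)) := by
          have : 0 ≤ (2 * m + 1) * (m + 1) - m ^ 2 := by nlinarith
          positivity
        linarith
      have h3 := abs_sub_le (s (n + (k + 1))) (s (n + k)) (s n)
      rw [← add_assoc] at h3 ⊢
      rw [← add_assoc] at h2
      linarith
  have hlim : Tendsto (fun k => |s (n + k) - s n|) atTop (𝓝 |0 - s n|) :=
    (((tendsto_add_atTop_iff_nat n).mpr hs).congr fun k => by rw [add_comm]).sub_const _ |>.abs
  rw [zero_sub, abs_neg] at hlim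
  refine le_of_tendsto hlim (Eventually.of_forall fun k => (hk k).trans ?_)
  have : 0 ≤ c / ((n + k : ℕ) : ℝ) ^ 2 := by positivity
  linarith

/-! ### The two-term expansion of `n ^ p / Γ(p + 1)` -/

theorem isBigO_one_sub_rpow (p : ℝ) :
    (fun x : ℝ => (1 - x) ^ p - (1 - p * x + p * (p - 1) / 2 * x ^ 2)) =O[𝓝 0]
      fun x => x ^ 3 := by
  have h := (Real.one_add_rpow_hasFPowerSeriesAt_zero (a := p)).isBigO_sub_partialSum_pow 3
  have hneg : Tendsto (fun x : ℝ => -x) (𝓝 0) (𝓝 0) := by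
    simpa using (continuous_neg (G := ℝ)).tendsto 0
  have h1 := (h.comp_tendsto hneg).norm_right
  have hc1 : Ring.choose p 1 = p := by simp
  have hc2 : Ring.choose p 2 = p * (p - 1) / 2 := by
    have := succ_mul_choose_succ p 1
    rw [hc1] at this
    push_cast at this
    linarith
  refine (h1.congr_left fun x => ?_).trans (IsBigO.of_norm_right ?_)
  · simp [FormalMultilinearSeries.partialSum, Finset.sum_range_succ, hc2, sub_eq_add_neg,
      _root_.binomialSeries, FormalMultilinearSeries.coeff_ofScalars]
    ring
  · simpa using isBigO_refl (fun x : ℝ => |x| ^ 3) (𝓝 0)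

/-- With `x = 1 / (n + 1)`, the term compared with `1` is `r n / r (n + 1)`, where `r n` is the
quotient of `n ^ p` and `mainTerm p n`. -/
theorem isBigO_mainTerm_ratio (p : ℝ) :
    (fun x : ℝ => (1 - x) ^ p * ((1 + (p - 1) * x) * (1 + (p - p * (p + 1) / 2) * x))
      / (1 + (p - 1 - p * (p + 1) / 2) * x) - 1) =O[𝓝 0] fun x => x ^ 3 := by
  set κ := p * (p + 1) / 2 with hκ
  have hb : ∀ f : ℝ → ℝ, ContinuousAt f 0 → f =O[𝓝 0] fun _ => (1 : ℝ) := fun f hf =>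
    hf.isBigO_one ℝ
  have h1 : (fun x : ℝ => ((1 - x) ^ p - (1 - p * x + p * (p - 1) / 2 * x ^ 2))
      * ((1 + (p - 1) * x) * (1 + (p - κ) * x))) =O[𝓝 0] fun x => x ^ 3 * 1 :=
    (isBigO_one_sub_rpow p).mul (hb _ (by fun_prop))
  have h2 : (fun x : ℝ => x ^ 3 * (-p * (p - 1) * (p - κ) + p * (p - 1) / 2 * ((p - 1) + (p - κ))
      + p * (p - 1) / 2 * ((p - 1) * (p - κ)) * x)) =O[𝓝 0] fun x => x ^ 3 * 1 :=
    (isBigO_refl _ _).mul (hb _ (by fun_prop))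
  have hne : ∀ᶠ x : ℝ in 𝓝 0, 1 + (p - 1 - κ) * x ≠ 0 := by
    have hc : ContinuousAt (fun x : ℝ => 1 + (p - 1 - κ) * x) 0 := by fun_prop
    exact hc.eventually_ne (by norm_num)
  have h3 : (fun x : ℝ => (1 + (p - 1 - κ) * x)⁻¹) =O[𝓝 0] fun _ => (1 : ℝ) :=
    hb _ (ContinuousAt.inv₀ (by fun_prop) (by norm_num))
  refine ((h1.add h2).mul h3).congr' ?_ (Eventually.of_forall fun x => by ring)
  filter_upwards [hne] with x hx
  rw [eq_sub_iff_add_eq, eq_div_iff hx, add_mul, mul_assoc, inv_mul_cancel₀ hx]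
  rw [hκ]
  ring

theorem tendsto_inv_succ : Tendsto (fun n : ℕ => ((n : ℝ) + 1)⁻¹) atTop (𝓝 0) := by
  simpa using tendsto_one_div_add_atTop_nhds_zero_nat (𝕜 := ℝ)

/-- The `n`-th coefficient of `(1 - X) ^ (-p - 1) - ((p + 1) / 2) (1 - X) ^ (-p)`, which agrees
with `n ^ p / Γ(p + 1)` up to two orders. -/
def mainTerm (p : ℝ) (n : ℕ) : ℝ := subCoeff (-p - 1) n - (p + 1) / 2 * subCoeff (-p) n

theorem add_mul_mainTerm (p : ℝ) (n : ℕ) :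
    ((n : ℝ) + p) * mainTerm p n = (n + p - p * (p + 1) / 2) * subCoeff (-p - 1) n := by
  rw [mainTerm]
  linear_combination (-(p + 1) / 2) * add_mul_subCoeff_neg p n

theorem mainTerm_succ_sub (p : ℝ) (n : ℕ) : mainTerm p (n + 1) - mainTerm p n
    = subCoeff (-p) (n + 1) - (p + 1) / 2 * subCoeff (-(p - 1)) (n + 1) := by
  have h1 := subCoeff_add_one_succ (-p - 1) n
  have h2 := subCoeff_add_one_succ (-p) n
  rw [show -p + 1 = -(p - 1) by ring] at h2
  rw [show -p - 1 + 1 = -p by ring] at h1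
  rw [mainTerm, mainTerm]
  linear_combination (-(p + 1) / 2) * (-h2) - h1

theorem eventually_lt_natCast (c : ℝ) : ∀ᶠ n : ℕ in atTop, c < n :=
  tendsto_natCast_atTop_atTop.eventually_gt_atTop c

/-- The quotient of `n ^ p / Γ(p + 1)` and `mainTerm p n` tends to `1`, with error `O(n ^ (-2))`
and increments `O(n ^ (-3))`. -/
theorem isBigO_gridPow_div_mainTerm {p : ℝ} (hp : -1 < p) :
    (fun n : ℕ => (n : ℝ) ^ p / Real.Gamma (p + 1) / mainTerm p n - 1) =O[atTop]
        (fun n : ℕ => ((n : ℝ) ^ 2)⁻¹) ∧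
    (fun n : ℕ => ((n + 1 : ℕ) : ℝ) ^ p / Real.Gamma (p + 1) / mainTerm p (n + 1)
        - (n : ℝ) ^ p / Real.Gamma (p + 1) / mainTerm p n) =O[atTop]
        (fun n : ℕ => (((n : ℝ) + 1) ^ 3)⁻¹) := by
  set κ := p * (p + 1) / 2 with hκ
  have hΓ : 0 < Real.Gamma (p + 1) := Real.Gamma_pos_of_pos (by linarith)
  set r : ℕ → ℝ := fun n => (n : ℝ) ^ p / Real.Gamma (p + 1) / mainTerm p n with hr
  have hr1 : Tendsto r atTop (𝓝 1) := by
    have h1 := (tendsto_rpow_div_subCoeff hp).div_const (Real.Gamma (p + 1))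
    rw [div_self hΓ.ne'] at h1
    have h2 : Tendsto (fun n : ℕ => (1 + p / (n : ℝ)) / (1 + (p - κ) / (n : ℝ))) atTop
        (𝓝 ((1 + 0) / (1 + 0))) :=
      (tendsto_const_nhds.add (tendsto_const_div_atTop_nhds_zero_nat _)).div
        (tendsto_const_nhds.add (tendsto_const_div_atTop_nhds_zero_nat _)) (by norm_num)
    have h3 := h1.mul h2
    rw [add_zero, div_one, mul_one] at h3
    refine h3.congr' ?_
    filter_upwards [eventually_lt_natCast 0, eventually_lt_natCast (-p),
      eventually_lt_natCast (κ - p)] with n hn hn1 hn2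
    have hc := subCoeff_pos (show -p - 1 < 0 by linarith) n
    have e1 : 0 < (n : ℝ) + p := by linarith
    have e2 : 0 < (n : ℝ) + p - κ := by linarith
    have e3 : mainTerm p n = (n + p - κ) * subCoeff (-p - 1) n / (n + p) := by
      rw [eq_div_iff e1.ne', mul_comm, add_mul_mainTerm]
    have e4 : (n : ℝ) + (p - κ) = n + p - κ := by ring
    rw [hr]
    dsimp only
    rw [e3]
    have e5 : 1 + (p - κ) / (n : ℝ) = (n + p - κ) / n := by field_simp; ring
    rw [e5]
    field_simp
  -- `r n = r (n + 1) * (1 + O(n ^ (-3)))`, where `r` is bounded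
  have hE := (isBigO_mainTerm_ratio p).comp_tendsto tendsto_inv_succ
  rw [← hκ] at hE
  have hdiff : (fun n => r (n + 1) - r n) =O[atTop] (fun n : ℕ => (((n : ℝ) + 1) ^ 3)⁻¹) := by
    have hb : (fun n => -r (n + 1)) =O[atTop] fun _ => (1 : ℝ) :=
      ((hr1.comp (tendsto_add_atTop_nat 1)).neg).isBigO_one ℝ
    refine (hb.mul hE).congr' ?_ (Eventually.of_forall fun n => by simp)
    filter_upwards [eventually_lt_natCast 0, eventually_lt_natCast (-p),
      eventually_lt_natCast (κ - p)] with n hn hn1 hn2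
    have hc := subCoeff_pos (show -p - 1 < 0 by linarith) n
    have e1 : 0 < (n : ℝ) + p := by linarith
    have e2 : 0 < (n : ℝ) + p - κ := by linarith
    have e1' : 0 < (n : ℝ) + 1 + p := by linarith
    have e2' : 0 < (n : ℝ) + 1 + p - κ := by linarith
    have e3 : mainTerm p n = (n + p - κ) * subCoeff (-p - 1) n / (n + p) := by
      rw [eq_div_iff e1.ne', mul_comm, add_mul_mainTerm]
    have hcs : subCoeff (-p - 1) (n + 1) = (n + 1 + p) * subCoeff (-p - 1) n / (n + 1) := by
      rw [eq_div_iff (by positivity)]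
      linear_combination subCoeff_succ (-p - 1) n
    have e3' : mainTerm p (n + 1) = (n + 1 + p - κ) * subCoeff (-p - 1) n / (n + 1) := by
      have h := add_mul_mainTerm p (n + 1)
      rw [hcs] at h
      push_cast at h
      rw [eq_div_iff (by positivity)]
      have h6 : ((n : ℝ) + 1 + p) * (mainTerm p (n + 1) * (n + 1)
          - (n + 1 + p - κ) * subCoeff (-p - 1) n) = 0 := by
        rw [mul_sub, ← mul_assoc, h]
        field_simp
        ring
      have := (mul_eq_zero.mp h6).resolve_left e1'.ne'
      linarith
    have e7 : (n : ℝ) ^ p = (1 - ((n : ℝ) + 1)⁻¹) ^ p * ((n : ℝ) + 1) ^ p := by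
      rw [← Real.mul_rpow]
      · congr 1
        field_simp
        ring
      · have : ((n : ℝ) + 1)⁻¹ ≤ 1 := inv_le_one_of_one_le₀ (by linarith)
        linarith
      · positivity
    simp only [hr, Function.comp_apply]
    rw [e3, e3', e7]
    push_cast
    have d1 : 1 + (p - 1 - κ) * ((n : ℝ) + 1)⁻¹ = (n + p - κ) / (n + 1) := by field_simp; ring
    have d2 : 1 + (p - 1) * ((n : ℝ) + 1)⁻¹ = (n + p) / (n + 1) := by field_simp; ring
    have d3 : 1 + (p - κ) * ((n : ℝ) + 1)⁻¹ = (n + 1 + p - κ) / (n + 1) := by field_simp; ring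
    rw [d1, d2, d3]
    generalize (1 - ((n : ℝ) + 1)⁻¹) ^ p = A
    field_simp
    ring
  refine ⟨?_, hdiff⟩
  obtain ⟨c, hc, hcb⟩ := hdiff.exists_pos
  obtain ⟨n₀, hn₀⟩ := eventually_atTop.mp hcb.bound
  have hs : Tendsto (fun n => r n - 1) atTop (𝓝 0) := by simpa using hr1.sub_const 1
  refine IsBigO.of_bound c ?_
  filter_upwards [eventually_ge_atTop (max n₀ 1)] with n hn
  have h := abs_le_of_abs_sub_le hs (le_max_right n₀ 1) hc.le (fun k hk => ?_) hn
  · simpa [hr, div_eq_mul_inv] using h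
  · have := hn₀ k ((le_max_left _ _).trans hk)
    have h3 : 0 < (k : ℝ) + 1 := by positivity
    simpa [div_eq_mul_inv, abs_of_pos h3] using this

/-- The generating series of `n ^ p / Γ(p + 1)`. -/
def gridPow (p : ℝ) : ℂ⟦X⟧ :=
  PowerSeries.mk fun n => (((n : ℝ) ^ p / Real.Gamma (p + 1) : ℝ) : ℂ)

/-- The error of the approximation of `n ^ p / Γ(p + 1)` by `mainTerm p n`. -/
def gridRem (p : ℝ) : ℂ⟦X⟧ :=
  gridPow p - (oneSubPow (-p - 1) - C ((p + 1) / 2 : ℂ) * oneSubPow (-p))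

theorem coeff_gridRem (p : ℝ) (n : ℕ) :
    coeff n (gridRem p) = (((n : ℝ) ^ p / Real.Gamma (p + 1) - mainTerm p n : ℝ) : ℂ) := by
  simp [gridRem, gridPow, mainTerm]

/-- The error is two orders smaller than `n ^ p`, and its differences are three orders smaller. -/
theorem isBigO_gridRem {p : ℝ} (hp : -1 < p) :
    (fun n => coeff n (gridRem p)) =O[atTop] (fun n : ℕ => (n : ℝ) ^ (p - 2)) ∧
    (fun n => coeff n ((1 - X) * gridRem p)) =O[atTop] (fun n : ℕ => (n : ℝ) ^ (p - 3)) := by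
  obtain ⟨h1, h2⟩ := isBigO_gridPow_div_mainTerm hp
  have hc0 := isBigO_subCoeff_rpow hp
  have hc1 := isBigO_subCoeff_neg hc0
  have hc2 : subCoeff (-(p - 1)) =O[atTop] fun n : ℕ => (n : ℝ) ^ (p - 1 - 1) := by
    refine isBigO_subCoeff_neg ?_
    rwa [show -(p - 1) - 1 = -p by ring]
  have hle : ∀ a b : ℝ, a ≤ b →
      (fun n : ℕ => (n : ℝ) ^ a) =O[atTop] fun n : ℕ => (n : ℝ) ^ b := by
    intro a b hab
    refine IsBigO.of_bound 1 ?_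
    filter_upwards [eventually_ge_atTop 1] with n hn
    have hn1 : (1 : ℝ) ≤ n := by exact_mod_cast hn
    rw [one_mul, Real.norm_of_nonneg (by positivity), Real.norm_of_nonneg (by positivity)]
    exact Real.rpow_le_rpow_of_exponent_le hn1 hab
  have hy : mainTerm p =O[atTop] fun n : ℕ => (n : ℝ) ^ p :=
    hc0.sub ((hc1.trans (hle _ _ (by linarith))).const_mul_left _)
  have hpos : ∀ᶠ n in atTop, mainTerm p n ≠ 0 := by
    filter_upwards [eventually_lt_natCast (-p),
      eventually_lt_natCast (p * (p + 1) / 2 - p)] with n hn1 hn2 h0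
    have h := add_mul_mainTerm p n
    rw [h0, mul_zero] at h
    have hc := subCoeff_pos (show -p - 1 < 0 by linarith) n
    have : 0 < ((n : ℝ) + p - p * (p + 1) / 2) * subCoeff (-p - 1) n :=
      mul_pos (by linarith) hc
    linarith
  constructor
  · have h3 := hy.mul h1
    have h4 : (fun n => coeff n (gridRem p)) =O[atTop]
        fun n : ℕ => (n : ℝ) ^ p * ((n : ℝ) ^ 2)⁻¹ := by
      refine IsBigO.of_norm_left (h3.norm_left.congr' ?_ EventuallyEq.rfl)
      filter_upwards [hpos] with n hn
      rw [coeff_gridRem, Complex.norm_real]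
      congr 1
      field_simp
    refine h4.congr' EventuallyEq.rfl ?_
    filter_upwards [eventually_lt_natCast 0] with n hn
    rw [Real.rpow_sub hn, div_eq_mul_inv, Real.rpow_ofNat]
  · have hshift : Tendsto (fun n : ℕ => n + 1) atTop atTop := tendsto_add_atTop_nat 1
    have hd : (fun n => mainTerm p (n + 1) - mainTerm p n) =O[atTop]
        fun n : ℕ => ((n + 1 : ℕ) : ℝ) ^ (p - 1) := by
      simp only [mainTerm_succ_sub]
      exact (hc1.comp_tendsto hshift).sub
        (((hc2.trans (hle _ _ (by linarith))).comp_tendsto hshift).const_mul_left _)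
    have hy' : mainTerm p =O[atTop] fun n : ℕ => ((n + 1 : ℕ) : ℝ) ^ p := by
      have h5 := (hy.comp_tendsto hshift).sub
        (hd.trans ((hle (p - 1) p (by linarith)).comp_tendsto hshift))
      refine h5.congr_left fun n => ?_
      simp
    have h6 := (hd.mul (h1.comp_tendsto hshift))
    have h7 := hy'.mul h2
    have h6' : (fun n => (mainTerm p (n + 1) - mainTerm p n) *
        (((n + 1 : ℕ) : ℝ) ^ p / Real.Gamma (p + 1) / mainTerm p (n + 1) - 1)) =O[atTop]
        fun n : ℕ => ((n + 1 : ℕ) : ℝ) ^ (p - 3) := by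
      refine h6.congr' EventuallyEq.rfl (Eventually.of_forall fun n => ?_)
      have hn : (0 : ℝ) < ((n + 1 : ℕ) : ℝ) := by positivity
      simp only [Function.comp_apply]
      rw [show p - 3 = p - 1 - 2 by ring, Real.rpow_sub hn (p - 1), Real.rpow_ofNat,
        div_eq_mul_inv]
    have h7' : (fun n => mainTerm p n *
        (((n + 1 : ℕ) : ℝ) ^ p / Real.Gamma (p + 1) / mainTerm p (n + 1)
        - (n : ℝ) ^ p / Real.Gamma (p + 1) / mainTerm p n)) =O[atTop]
        fun n : ℕ => ((n + 1 : ℕ) : ℝ) ^ (p - 3) := by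
      refine h7.congr' EventuallyEq.rfl (Eventually.of_forall fun n => ?_)
      have hn : (0 : ℝ) < ((n + 1 : ℕ) : ℝ) := by positivity
      dsimp only
      rw [Real.rpow_sub hn, Real.rpow_ofNat, div_eq_mul_inv]
      push_cast
      rfl
    -- product rule for the differences of `mainTerm p n * (r n - 1)`
    rw [← map_add_atTop_eq_nat 1, isBigO_map]
    refine IsBigO.of_norm_left ((h6'.add h7').norm_left.congr' ?_ EventuallyEq.rfl)
    filter_upwards [hpos, hshift.eventually hpos] with n hn hn1
    rw [Function.comp_apply, coeff_succ_one_sub_X_mul, coeff_gridRem, coeff_gridRem,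
      ← Complex.ofReal_sub, Complex.norm_real]
    congr 1
    generalize mainTerm p (n + 1) = y' at hn1
    generalize mainTerm p n = y at hn
    field_simp
    ring

/-! ### Fractional differences of the quadrature and Taylor errors -/

theorem wienerNorm_one_sub_X_ne_top : wienerNorm (1 - X) ≠ ⊤ := by
  rw [sub_eq_add_neg]
  refine ne_top_of_le_ne_top ?_ (wienerNorm_add_le _ _)
  simp [wienerNorm_neg, wienerNorm_one, wienerNorm_X]

theorem Vanishing.one_sub_X_mul {f : ℂ⟦X⟧} (hf : Vanishing f) : Vanishing ((1 - X) * f) :=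
  hf.mul_left wienerNorm_one_sub_X_ne_top

theorem Vanishing.X_mul {f : ℂ⟦X⟧} (hf : Vanishing f) : Vanishing (X * f) :=
  hf.mul_left (by simp [wienerNorm_X])

theorem vanishing_gridRem {p : ℝ} (hp : -1 < p) (hp2 : p < 2) : Vanishing (gridRem p) := by
  refine (isBigO_gridRem hp).1.trans_tendsto ?_
  have h := (tendsto_rpow_neg_atTop (y := 2 - p) (by linarith)).comp
    (tendsto_natCast_atTop_atTop (R := ℝ))
  rw [show p - 2 = -(2 - p) by ring]
  exact h

theorem vanishing_oneSubPow_mul_gridRem {β p : ℝ} (h0 : 0 < β) (h1 : β < 1) (hp : -1 < p)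
    (hpβ : p < 2 + β) : Vanishing (oneSubPow β * gridRem p) := by
  -- the maximum makes `γ` positive, also for `p ≤ 2`
  refine vanishing_oneSubPow_mul (γ := max (p - 2) (β / 2)) h1
    (lt_max_of_lt_right (by linarith)) (max_lt (by linarith) (by linarith))
    ((isBigO_gridRem hp).2.trans ?_)
  refine IsBigO.of_bound 1 ?_
  filter_upwards [eventually_ge_atTop 1] with n hn
  have hn1 : (1 : ℝ) ≤ n := by exact_mod_cast hn
  rw [one_mul, Real.norm_of_nonneg (by positivity), Real.norm_of_nonneg (by positivity)]
  exact Real.rpow_le_rpow_of_exponent_le hn1 (by linarith [le_max_left (p - 2) (β / 2)])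

theorem gridPow_eq (p : ℝ) : gridPow p
    = oneSubPow (-p - 1) - C ((p + 1) / 2 : ℂ) * oneSubPow (-p) + gridRem p := by
  rw [gridRem]; ring

/-- The error of the convolution quadrature for `t ^ θ`, multiplied by `(1 - X) ^ β`. Since `((1 +
X) / 2) ^ β = 1 - (β / 2) (1 - X) + O((1 - X) ^ 2)`, the two leading terms of the expansions of `n
^ (θ + β)` and `n ^ θ` cancel: the quadrature has order two. -/
theorem vanishing_quadrature_error {β θ : ℝ} (h0 : 0 < β) (h1 : β < 1) (hθ0 : 0 ≤ θ)
    (hθ : θ < 2) :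
    Vanishing (oneSubPow β * gridPow (θ + β) - halfAddPow β * gridPow θ) := by
  obtain ⟨q, hq, hqe⟩ := exists_halfAddPow_eq h0.le h1
  have e1 : oneSubPow β * oneSubPow (-(θ + β) - 1) = oneSubPow (-θ - 1) := by
    rw [oneSubPow_mul]; congr 1; ring
  have e2 : oneSubPow β * oneSubPow (-(θ + β)) = oneSubPow (-θ) := by
    rw [oneSubPow_mul]; congr 1; ring
  have e3 : (1 - X) * oneSubPow (-θ - 1) = oneSubPow (-θ) := by
    rw [one_sub_X_mul_oneSubPow]; congr 1; ring
  have e4 : (1 - X) * oneSubPow (-θ) = oneSubPow (1 - θ) := by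
    rw [one_sub_X_mul_oneSubPow]; congr 1; ring
  have ec : (C (((θ + β : ℝ) + 1) / 2 : ℂ) : ℂ⟦X⟧)
      = C ((θ + 1) / 2 : ℂ) + C (β / 2 : ℂ) := by
    rw [← map_add]; congr 1; push_cast; ring
  have key : oneSubPow β * gridPow (θ + β) - halfAddPow β * gridPow θ
      = oneSubPow β * gridRem (θ + β) - halfAddPow β * gridRem θ - q * oneSubPow (1 - θ)
        + C ((θ + 1) / 2 : ℂ) * (q * ((1 - X) * oneSubPow (1 - θ))
          - C (β / 2 : ℂ) * oneSubPow (1 - θ)) := by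
    have hA : halfAddPow β * oneSubPow (-θ - 1) = oneSubPow (-θ - 1)
        - C (β / 2 : ℂ) * oneSubPow (-θ) + q * oneSubPow (1 - θ) := by
      rw [hqe]
      linear_combination (-C (β / 2 : ℂ) + (1 - X) * q) * e3 + q * e4
    have hB : halfAddPow β * oneSubPow (-θ) = oneSubPow (-θ)
        - C (β / 2 : ℂ) * oneSubPow (1 - θ) + q * ((1 - X) * oneSubPow (1 - θ)) := by
      rw [hqe]
      linear_combination (-C (β / 2 : ℂ) + (1 - X) * q) * e4
    rw [gridPow_eq (θ + β), gridPow_eq θ, ec]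
    linear_combination e1 - (C ((θ + 1) / 2 : ℂ) + C (β / 2 : ℂ)) * e2 - hA
      + C ((θ + 1) / 2 : ℂ) * hB
  have hB := vanishing_oneSubPow (show -1 < 1 - θ by linarith)
  rw [key]
  exact (((vanishing_oneSubPow_mul_gridRem h0 h1 (by linarith) (by linarith)).sub
    ((vanishing_gridRem (by linarith) hθ).mul_left (wienerNorm_halfAddPow_ne_top h0.le h1))).sub
    (hB.mul_left hq)).add (((hB.one_sub_X_mul.mul_left hq).sub (hB.C_mul _)).C_mul _)

/-- The error `n ^ δ - (n - 1) ^ δ - δ (n - 1) ^ (δ - 1)` of the Taylor expansion, divided by `Γ(δ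
+ 1)`, has a fractional difference that tends to `0`. -/
theorem vanishing_taylor_error {β δ : ℝ} (h0 : 0 < β) (h1 : β < 1) (hδ0 : 0 < δ)
    (hδ : δ < 2 + β) :
    Vanishing (oneSubPow β * ((1 - X) * gridPow δ - X * gridPow (δ - 1))) := by
  have e1 : oneSubPow β * oneSubPow (-δ - 1) = oneSubPow (β - δ - 1) := by
    rw [oneSubPow_mul]; congr 1; ring
  have e2 : oneSubPow β * oneSubPow (-δ) = oneSubPow (β - δ) := by
    rw [oneSubPow_mul]; congr 1
  have e2' : oneSubPow β * oneSubPow (-(δ - 1)) = oneSubPow (β + 1 - δ) := by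
    rw [oneSubPow_mul]; congr 1; ring
  have e3 : (1 - X) * oneSubPow (β - δ - 1) = oneSubPow (β - δ) := by
    rw [one_sub_X_mul_oneSubPow]; congr 1; ring
  have e4 : (1 - X) * oneSubPow (β - δ) = oneSubPow (β + 1 - δ) := by
    rw [one_sub_X_mul_oneSubPow]; congr 1; ring
  have e5 : gridPow (δ - 1)
      = oneSubPow (-δ) - C (δ / 2 : ℂ) * oneSubPow (-(δ - 1)) + gridRem (δ - 1) := by
    rw [gridPow_eq]
    congr 3
    · ring
    · congr 2; push_cast; ring
  have key : oneSubPow β * ((1 - X) * gridPow δ - X * gridPow (δ - 1))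
      = oneSubPow (β + 1 - δ) - C ((δ + 1) / 2 : ℂ) * oneSubPow (β + 1 - δ)
        + C (δ / 2 : ℂ) * (X * oneSubPow (β + 1 - δ))
        + (1 - X) * (oneSubPow β * gridRem δ) - X * (oneSubPow β * gridRem (δ - 1)) := by
    rw [e5, gridPow_eq δ]
    linear_combination (1 - X) * e1 - (C ((δ + 1) / 2 : ℂ) * (1 - X) + X) * e2
      + X * C (δ / 2 : ℂ) * e2' + e3 + (1 - C ((δ + 1) / 2 : ℂ)) * e4
  have hB := vanishing_oneSubPow (show -1 < β + 1 - δ by linarith)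
  rw [key]
  exact (((hB.sub (hB.C_mul _)).add (hB.X_mul.C_mul _)).add
    (vanishing_oneSubPow_mul_gridRem h0 h1 (by linarith) hδ).one_sub_X_mul).sub
    (vanishing_oneSubPow_mul_gridRem h0 h1 (by linarith) (by linarith)).X_mul

theorem subCoeff_neg_one (n : ℕ) : subCoeff (-1) n = 1 := by
  induction n with
  | zero => simp
  | succ n ih =>
    have h := subCoeff_succ (-1) n
    rw [ih, mul_one, sub_neg_eq_add] at h
    exact mul_left_cancel₀ (by positivity : (n : ℝ) + 1 ≠ 0) (h.trans (mul_one _).symm)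

theorem wienerNorm_ne_top_of_eventually_eq_zero {f : ℂ⟦X⟧}
    (hf : ∀ᶠ n in atTop, coeff n f = 0) : wienerNorm f ≠ ⊤ := by
  refine wienerNorm_ne_top_of_summable ?_
  obtain ⟨N, hN⟩ := eventually_atTop.mp hf
  refine summable_of_ne_finset_zero (s := Finset.range N) fun n hn => ?_
  rw [hN n (by simpa using hn), norm_zero]

/-! ### Sequences with fractional difference tending to zero -/

/-- The fractional difference `(1 - X) ^ β g` of the sequence `g` tends to zero. -/
def FracNull (β : ℝ) (g : ℕ → ℂ) : Prop := Vanishing (oneSubPow β * PowerSeries.mk g)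

theorem mk_add (f g : ℕ → ℂ) : PowerSeries.mk (fun n => f n + g n)
    = PowerSeries.mk f + PowerSeries.mk g := by
  ext n; simp

theorem mk_const_mul (c : ℂ) (f : ℕ → ℂ) : PowerSeries.mk (fun n => c * f n)
    = C c * PowerSeries.mk f := by
  ext n; simp

theorem FracNull.add {β : ℝ} {f g : ℕ → ℂ} (hf : FracNull β f) (hg : FracNull β g) :
    FracNull β fun n => f n + g n := by
  rw [FracNull, mk_add, mul_add]
  exact Vanishing.add hf hg

theorem FracNull.const_mul {β : ℝ} {f : ℕ → ℂ} (hf : FracNull β f) (c : ℂ) :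
    FracNull β fun n => c * f n := by
  rw [FracNull, mk_const_mul, mul_left_comm]
  exact Vanishing.C_mul hf c

theorem FracNull.mul_const {β : ℝ} {f : ℕ → ℂ} (hf : FracNull β f) (c : ℂ) :
    FracNull β fun n => f n * c := by
  simpa only [mul_comm] using hf.const_mul c

theorem FracNull.zero (β : ℝ) : FracNull β fun _ => 0 := by
  have : PowerSeries.mk (fun _ : ℕ => (0 : ℂ)) = 0 := by ext n; simp
  rw [FracNull, this, mul_zero]
  simp [Vanishing]

theorem FracNull.sum {β : ℝ} {ι : Type*} (s : Finset ι) {f : ι → ℕ → ℂ}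
    (hf : ∀ i ∈ s, FracNull β (f i)) : FracNull β fun n => ∑ i ∈ s, f i n := by
  classical
  induction s using Finset.induction_on with
  | empty => simpa using FracNull.zero β
  | insert a s ha ih =>
    simp only [Finset.sum_insert ha]
    exact (hf a (Finset.mem_insert_self a s)).add
      (ih fun i hi => hf i (Finset.mem_insert_of_mem hi))

theorem FracNull.congr' {β : ℝ} (h0 : 0 < β) {f g : ℕ → ℂ} (hf : FracNull β f)
    (hfg : f =ᶠ[atTop] g) : FracNull β g := by
  have h1 : PowerSeries.mk g = PowerSeries.mk f + (PowerSeries.mk g - PowerSeries.mk f) := by ring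
  rw [FracNull, h1, mul_add]
  refine Vanishing.add hf ?_
  rw [mul_comm]
  refine (vanishing_oneSubPow (by linarith)).mul_left
    (wienerNorm_ne_top_of_eventually_eq_zero ?_)
  filter_upwards [hfg] with n hn
  simp [hn]

theorem fracNull_const {β : ℝ} (h0 : 0 < β) (c : ℂ) : FracNull β fun _ => c := by
  have h1 : PowerSeries.mk (fun _ : ℕ => (1 : ℂ)) = oneSubPow (-1) := by
    ext n; simp [subCoeff_neg_one]
  have h2 : FracNull β fun _ => 1 := by
    rw [FracNull, h1, oneSubPow_mul]
    exact vanishing_oneSubPow (by linarith)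
  simpa using h2.const_mul c

theorem fracNull_of_tendsto {β : ℝ} (h0 : 0 < β) (h1 : β < 1) {g : ℕ → ℂ} {l : ℂ}
    (hg : Tendsto g atTop (𝓝 l)) : FracNull β g := by
  have h2 : FracNull β fun n => g n - l := by
    refine Vanishing.mul_left (wienerNorm_oneSubPow_ne_top h0.le h1) ?_
    simpa [Vanishing] using hg.sub_const l
  simpa using h2.add (fracNull_const h0 l)

/-! ### The generating function `ω^{(β)}` -/

theorem re_sq_add_im_sq_le_one {z : ℂ} (hz : ‖z‖ ≤ 1) : z.re ^ 2 + z.im ^ 2 ≤ 1 := by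
  have h := pow_le_one₀ (norm_nonneg z) hz (n := 2)
  rw [Complex.sq_norm, Complex.normSq_apply] at h
  linarith

theorem re_lt_one {z : ℂ} (hz : ‖z‖ ≤ 1) (h1 : z ≠ 1) : z.re < 1 := by
  refine lt_of_le_of_ne (re_le_one hz) fun h => h1 ?_
  have h2 := re_sq_add_im_sq_le_one hz
  have h3 : z.im = 0 := by
    rw [h] at h2
    nlinarith [sq_nonneg z.im]
  exact Complex.ext h h3

theorem neg_one_lt_re {z : ℂ} (hz : ‖z‖ ≤ 1) (h1 : z ≠ -1) : -1 < z.re := by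
  have := re_lt_one (z := -z) (by simpa using hz) (fun h => h1 (by rw [← h, neg_neg]))
  simp only [Complex.neg_re] at this
  linarith

/-- The base of the power that defines `ω^{(β)}` lies in the closed right half plane. -/
theorem re_moebius_nonneg {z : ℂ} (hz : ‖z‖ ≤ 1) : 0 ≤ (1 / 2 * ((1 + z) / (1 - z))).re := by
  have h2 := re_sq_add_im_sq_le_one hz
  have h3 : (1 / 2 * ((1 + z) / (1 - z))).re
      = 1 / 2 * ((1 - (z.re ^ 2 + z.im ^ 2)) / Complex.normSq (1 - z)) := by
    rw [show (1 / 2 : ℂ) = ((1 / 2 : ℝ) : ℂ) by push_cast; rfl, Complex.re_ofReal_mul,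
      Complex.div_re]
    simp only [Complex.add_re, Complex.sub_re, Complex.one_re, Complex.add_im, Complex.sub_im,
      Complex.one_im]
    ring
  rw [h3]
  have := Complex.normSq_nonneg (1 - z)
  exact mul_nonneg (by norm_num) (div_nonneg (by linarith) this)

/-- The identity `ω^{(β)}(z) (1 - z) ^ β = ((1 + z) / 2) ^ β`; principal powers are multiplicative
here because the arguments of the two factors sum to an angle in `(-π, π)`. -/
theorem genFun_mul_one_sub_cpow {β : ℝ} (h0 : 0 < β) {z : ℂ} (hz : ‖z‖ ≤ 1) (h1 : z ≠ 1) :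
    genFun β z * (1 - z) ^ (β : ℂ) = ((1 + z) / 2) ^ (β : ℂ) := by
  have hβ : (β : ℂ) ≠ 0 := by exact_mod_cast h0.ne'
  by_cases hm : z = -1
  · subst hm
    simp [genFun, Complex.zero_cpow hβ]
  have hv : 1 - z ≠ 0 := sub_ne_zero.mpr (Ne.symm h1)
  have hu : 1 + z ≠ 0 := fun h => hm (by linear_combination h)
  set w := 1 / 2 * ((1 + z) / (1 - z)) with hw
  have hw0 : w ≠ 0 := mul_ne_zero (by norm_num) (div_ne_zero hu hv)
  have hwv : w * (1 - z) = (1 + z) / 2 := by rw [hw]; field_simp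
  have ha1 := Complex.abs_arg_le_pi_div_two_iff.mpr (re_moebius_nonneg hz)
  have ha2 : |(1 - z).arg| < Real.pi / 2 :=
    Complex.abs_arg_lt_pi_div_two_iff.mpr (Or.inl (by simpa using re_lt_one hz h1))
  rw [← hw] at ha1
  have hlog : Complex.log (w * (1 - z)) = Complex.log w + Complex.log (1 - z) := by
    rw [Complex.log_mul_eq_add_log_iff hw0 hv]
    rw [abs_le] at ha1
    rw [abs_lt] at ha2
    constructor <;> linarith
  rw [genFun, ← hw, ← hwv, Complex.cpow_def_of_ne_zero hw0, Complex.cpow_def_of_ne_zero hv,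
    Complex.cpow_def_of_ne_zero (mul_ne_zero hw0 hv), hlog, ← Complex.exp_add]
  ring_nf

theorem genFun_ne_zero (β : ℝ) {z : ℂ} (h1 : z ≠ 1) (hm : z ≠ -1) : genFun β z ≠ 0 := by
  have hv : 1 - z ≠ 0 := sub_ne_zero.mpr (Ne.symm h1)
  have hu : 1 + z ≠ 0 := fun h => hm (by linear_combination h)
  have hw0 : 1 / 2 * ((1 + z) / (1 - z)) ≠ 0 := mul_ne_zero (by norm_num) (div_ne_zero hu hv)
  rw [genFun, Complex.cpow_def_of_ne_zero hw0]
  exact Complex.exp_ne_zero _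

/-- The formal power series with the coefficients `ω_n^{(β)}`. -/
def omegaSeries (β : ℝ) : ℂ⟦X⟧ := PowerSeries.mk (omega β)

theorem omegaSeries_mul {β : ℝ} (h0 : 0 < β) (h1 : β < 1) :
    omegaSeries β * oneSubPow β = halfAddPow β := by
  -- unlike `omegaSeries`, this product is known to converge on the whole open disc
  suffices h : omegaSeries β = halfAddPow β * oneSubPow (-β) by
    rw [h, mul_assoc, oneSubPow_mul, neg_add_cancel, oneSubPow_zero, mul_one]
  have han : AnalyticAt ℂ (genFun β) 0 := by
    unfold genFun
    refine AnalyticAt.cpow ?_ analyticAt_const ?_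
    · refine analyticAt_const.mul (AnalyticAt.div ?_ ?_ (by norm_num)) <;> fun_prop
    · norm_num [Complex.mem_slitPlane_iff]
  refine eq_of_eventually_hasSum (F := genFun β) ?_ ?_
  · have h := han.hasFPowerSeriesAt
    rw [hasFPowerSeriesAt_iff] at h
    filter_upwards [h] with z hz
    simpa [omegaSeries, omega, FormalMultilinearSeries.coeff_ofScalars, mul_comm] using hz
  · filter_upwards [Metric.ball_mem_nhds (0 : ℂ) one_pos] with z hz
    rw [mem_ball_zero_iff] at hz
    have hz1 : z ≠ 1 := fun h => by simp [h] at hz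
    have ha := absConvAt_of_wienerNorm (wienerNorm_halfAddPow_ne_top h0.le h1) hz.le
    obtain ⟨M, hM⟩ := (vanishing_oneSubPow (show -1 < -β by linarith)).exists_bound
    have hb := absConvAt_of_bounded hM hz
    have h2 := (ha.mul hb).hasSum
    rw [ha.eval_mul hb, eval_halfAddPow h0 h1 hz.le,
      show eval (oneSubPow (-β)) z = _ from (hasSum_oneSubPow (-β) hz).tsum_eq] at h2
    convert! h2 using 1
    rw [← genFun_mul_one_sub_cpow h0 hz.le hz1, mul_assoc, Complex.ofReal_neg, Complex.cpow_neg,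
      mul_inv_cancel₀, mul_one]
    rw [Complex.cpow_def_of_ne_zero (sub_ne_zero.mpr (Ne.symm hz1))]
    exact Complex.exp_ne_zero _

/-! ### The characteristic series, and decay off the reciprocal values -/

/-- The series `(1 - X) ^ β (1 - ξ ω^{(β)}) = (1 - X) ^ β - ξ ((1 + X) / 2) ^ β`, which, unlike
`ω^{(β)}` itself, converges absolutely on the closed disc. -/
def charSeries (β : ℝ) (ξ : ℂ) : ℂ⟦X⟧ := oneSubPow β - C ξ * halfAddPow β

theorem one_sub_omegaSeries_mul {β : ℝ} (h0 : 0 < β) (h1 : β < 1) (ξ : ℂ) :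
    (1 - C ξ * omegaSeries β) * oneSubPow β = charSeries β ξ := by
  rw [charSeries, ← omegaSeries_mul h0 h1]
  ring

theorem wienerNorm_C_mul_ne_top (c : ℂ) {f : ℂ⟦X⟧} (hf : wienerNorm f ≠ ⊤) :
    wienerNorm (C c * f) ≠ ⊤ := by
  refine ne_top_of_le_ne_top (ENNReal.mul_ne_top ?_ hf) (wienerNorm_mul_le _ _)
  rw [wienerNorm_C]
  exact enorm_ne_top

theorem charSeries_eq_add (β : ℝ) (ξ : ℂ) :
    charSeries β ξ = oneSubPow β + C (-ξ) * halfAddPow β := by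
  rw [charSeries, map_neg]; ring

theorem wienerNorm_charSeries_ne_top {β : ℝ} (h0 : 0 < β) (h1 : β < 1) (ξ : ℂ) :
    wienerNorm (charSeries β ξ) ≠ ⊤ := by
  rw [charSeries_eq_add]
  exact ne_top_of_le_ne_top (ENNReal.add_ne_top.mpr ⟨wienerNorm_oneSubPow_ne_top h0.le h1,
    wienerNorm_C_mul_ne_top _ (wienerNorm_halfAddPow_ne_top h0.le h1)⟩) (wienerNorm_add_le _ _)

theorem eval_charSeries {β : ℝ} (h0 : 0 < β) (h1 : β < 1) (ξ : ℂ) {z : ℂ} (hz : ‖z‖ ≤ 1) :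
    eval (charSeries β ξ) z = (1 - z) ^ (β : ℂ) - ξ * ((1 + z) / 2) ^ (β : ℂ) := by
  have hA := wienerNorm_halfAddPow_ne_top h0.le h1
  rw [charSeries_eq_add, AbsConvAt.eval_add
    (absConvAt_of_wienerNorm (wienerNorm_oneSubPow_ne_top h0.le h1) hz)
    (absConvAt_of_wienerNorm (wienerNorm_C_mul_ne_top _ hA) hz),
    AbsConvAt.eval_mul (absConvAt_of_wienerNorm (by rw [wienerNorm_C]; exact enorm_ne_top) hz)
    (absConvAt_of_wienerNorm hA hz), eval_oneSubPow h0 h1 hz, eval_halfAddPow h0 h1 hz]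
  have : eval (C (-ξ)) z = -ξ := by
    simpa using eval_polynomial (Polynomial.C (-ξ)) z
  rw [this]
  ring

theorem eval_charSeries_eq_genFun {β : ℝ} (h0 : 0 < β) (h1 : β < 1) (ξ : ℂ) {z : ℂ}
    (hz : ‖z‖ ≤ 1) (hz1 : z ≠ 1) :
    eval (charSeries β ξ) z = (1 - z) ^ (β : ℂ) * (1 - ξ * genFun β z) := by
  rw [eval_charSeries h0 h1 ξ hz, ← genFun_mul_one_sub_cpow h0 hz hz1]
  ring

theorem one_sub_cpow_ne_zero (β : ℝ) {z : ℂ} (hz1 : z ≠ 1) : (1 - z) ^ (β : ℂ) ≠ 0 := by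
  rw [Complex.cpow_def_of_ne_zero (sub_ne_zero.mpr (Ne.symm hz1))]
  exact Complex.exp_ne_zero _

theorem eval_charSeries_ne_zero {β : ℝ} (h0 : 0 < β) (h1 : β < 1) {ξ : ℂ}
    (hξ : ξ ∉ reciprocalValues β) {z : ℂ} (hz : ‖z‖ ≤ 1) : eval (charSeries β ξ) z ≠ 0 := by
  have hβ : (β : ℂ) ≠ 0 := by exact_mod_cast h0.ne'
  simp only [reciprocalValues, Set.mem_insert_iff, Set.mem_ofPred_eq, not_or, not_exists,
    not_and] at hξ
  by_cases hz1 : z = 1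
  · subst hz1
    rw [eval_charSeries h0 h1 ξ hz, sub_self, Complex.zero_cpow hβ]
    norm_num
    exact hξ.1
  rw [eval_charSeries_eq_genFun h0 h1 ξ hz hz1]
  refine mul_ne_zero (one_sub_cpow_ne_zero β hz1) fun h => ?_
  by_cases hm : z = -1
  · subst hm
    simp [genFun, Complex.zero_cpow hβ] at h
  · refine hξ.2 z hz hz1 hm ?_
    rw [eq_div_iff (genFun_ne_zero β hz1 hm)]
    linear_combination -h

theorem exists_eval_charSeries_eq_zero {β : ℝ} (h0 : 0 < β) (h1 : β < 1) {ξ : ℂ}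
    (hξ : ξ ∈ reciprocalValues β) (hξ0 : ξ ≠ 0) :
    ∃ z : ℂ, ‖z‖ ≤ 1 ∧ z ≠ 1 ∧ z ≠ -1 ∧ eval (charSeries β ξ) z = 0 := by
  rcases hξ with rfl | ⟨z, hz, hz1, hm, rfl⟩
  · exact absurd rfl hξ0
  · refine ⟨z, hz, hz1, hm, ?_⟩
    rw [eval_charSeries_eq_genFun h0 h1 _ hz hz1, one_div,
      inv_mul_cancel₀ (genFun_ne_zero β hz1 hm), sub_self, mul_zero]

/-- If `ξ` is not a reciprocal value, the characteristic series has an `ℓ¹` inverse by Wiener's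
lemma, and `y = charSeries⁻¹ (1 - X) ^ β g` tends to `0` as soon as `(1 - X) ^ β g` does. -/
theorem tendsto_zero_of_volterra {β : ℝ} (h0 : 0 < β) (h1 : β < 1) {ξ : ℂ}
    (hξ : ξ ∉ reciprocalValues β) {y g : ℕ → ℂ} (hg : FracNull β g)
    (h : (1 - C ξ * omegaSeries β) * PowerSeries.mk y = PowerSeries.mk g) :
    Tendsto y atTop (𝓝 0) := by
  have hinv := wienerNorm_inv_ne_top (wienerNorm_charSeries_ne_top h0 h1 ξ)
    fun z hz => eval_charSeries_ne_zero h0 h1 hξ hz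
  have hc : constantCoeff (charSeries β ξ) ≠ 0 := by
    have h2 := eval_charSeries_ne_zero h0 h1 hξ (z := 0) (by simp)
    rwa [eval, tsum_eq_single 0 (fun n hn => by simp [hn]), pow_zero, mul_one,
      coeff_zero_eq_constantCoeff_apply] at h2
  have hy : PowerSeries.mk y = (charSeries β ξ)⁻¹ * (oneSubPow β * PowerSeries.mk g) := by
    have h3 := PowerSeries.inv_mul_cancel _ hc
    have h4 := one_sub_omegaSeries_mul h0 h1 ξ
    linear_combination -PowerSeries.mk y * h3 + (charSeries β ξ)⁻¹ * (oneSubPow β * h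
      - PowerSeries.mk y * h4)
  have h5 : Vanishing (PowerSeries.mk y) := by
    rw [hy]
    exact Vanishing.mul_left hinv hg
  simpa [Vanishing] using h5

/-! ### No decay at a root of the characteristic series -/

/-- Abel's theorem for the series `(1 - X) f`, whose partial sums are the coefficients of `f`. -/
theorem tendsto_one_sub_mul_eval {f : ℂ⟦X⟧} (hf : Vanishing f) :
    Tendsto (fun t : ℝ => (1 - (t : ℂ)) * eval f t) (𝓝[<] 1) (𝓝 0) := by
  have hpart : ∀ n, ∑ i ∈ Finset.range (n + 1), coeff i ((1 - X) * f) = coeff n f := by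
    intro n
    induction n with
    | zero => simp
    | succ n ih => rw [Finset.sum_range_succ, ih, coeff_succ_one_sub_X_mul]; ring
  have h1 : Tendsto (fun n => ∑ i ∈ Finset.range n, coeff i ((1 - X) * f)) atTop (𝓝 0) := by
    rw [← tendsto_add_atTop_iff_nat 1]
    exact Tendsto.congr (fun n => (hpart n).symm) hf
  have h2 := Complex.tendsto_tsum_powerSeries_nhdsWithin_lt h1
  rw [tendsto_map'_iff] at h2
  refine h2.congr' ?_
  filter_upwards [Ioo_mem_nhdsLT (show (0 : ℝ) < 1 by norm_num)] with t ht
  obtain ⟨M, hM⟩ := hf.exists_bound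
  have ht1 : ‖(t : ℂ)‖ < 1 := by
    rw [Complex.norm_real, Real.norm_of_nonneg ht.1.le]; exact ht.2
  have ha := absConvAt_of_bounded hM ht1
  have hX : AbsConvAt (1 - X) (t : ℂ) :=
    absConvAt_of_wienerNorm wienerNorm_one_sub_X_ne_top ht1.le
  have h3 := hX.eval_mul ha
  have h4 : eval (1 - X) (t : ℂ) = 1 - t := by
    have h5 := eval_polynomial (1 - Polynomial.X) (t : ℂ)
    rwa [Polynomial.coe_sub, Polynomial.coe_one, Polynomial.coe_X, Polynomial.eval_sub,
      Polynomial.eval_one, Polynomial.eval_X] at h5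
  rw [h4] at h3
  exact h3

theorem eval_charSeries_mul {β : ℝ} (h0 : 0 < β) (h1 : β < 1) {ξ : ℂ} {y : ℂ⟦X⟧} {M : ℝ}
    (hM : ∀ n, ‖coeff n y‖ ≤ M) {c : ℂ} {k : ℕ}
    (hD : charSeries β ξ * y = C c * X ^ k * oneSubPow β) {z : ℂ} (hz : ‖z‖ < 1) :
    ((1 - z) ^ (β : ℂ) - ξ * ((1 + z) / 2) ^ (β : ℂ)) * eval y z
      = c * z ^ k * (1 - z) ^ (β : ℂ) := by
  have hPa : AbsConvAt (C c * X ^ k) z := by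
    have h := absConvAt_polynomial (Polynomial.C c * Polynomial.X ^ k) z
    rwa [Polynomial.coe_mul, Polynomial.coe_pow, Polynomial.coe_C, Polynomial.coe_X] at h
  have hPe : eval (C c * X ^ k) z = c * z ^ k := by
    have h := eval_polynomial (Polynomial.C c * Polynomial.X ^ k) z
    rwa [Polynomial.coe_mul, Polynomial.coe_pow, Polynomial.coe_C, Polynomial.coe_X,
      Polynomial.eval_mul, Polynomial.eval_pow, Polynomial.eval_C, Polynomial.eval_X] at h
  have hDa := absConvAt_of_wienerNorm (wienerNorm_charSeries_ne_top h0 h1 ξ) hz.le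
  have hBa := absConvAt_of_wienerNorm (wienerNorm_oneSubPow_ne_top h0.le h1) hz.le
  rw [← eval_charSeries h0 h1 ξ hz.le, ← hDa.eval_mul (absConvAt_of_bounded hM hz), hD,
    hPa.eval_mul hBa, hPe, eval_oneSubPow h0 h1 hz.le]

/-- If the characteristic series has a zero `z ≠ ±1` in the closed disc, a solution of `(1 - ξ ω)
y = c X ^ k` cannot tend to `0`: along the radius to `z` the characteristic function is `O(1 - t)`
and `(1 - t) y(t z)` tends to `0`, whereas `c (t z) ^ k (1 - t z) ^ β` does not. -/
theorem not_vanishing_of_root {β : ℝ} (h0 : 0 < β) (h1 : β < 1) {ξ z : ℂ} (hz : ‖z‖ ≤ 1)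
    (hz1 : z ≠ 1) (hzm : z ≠ -1) (hroot : eval (charSeries β ξ) z = 0) {y : ℂ⟦X⟧}
    (hy : Vanishing y) {c : ℂ} (hc : c ≠ 0) {k : ℕ} (hk : k = 0 ∨ z ≠ 0)
    (h : (1 - C ξ * omegaSeries β) * y = C c * X ^ k) : False := by
  have hD : charSeries β ξ * y = C c * X ^ k * oneSubPow β := by
    rw [← one_sub_omegaSeries_mul h0 h1, ← h]; ring
  set A : ℂ⟦X⟧ := rescale z y with hA
  have hAv : Vanishing A := by
    refine squeeze_zero_norm (fun n => ?_) (tendsto_zero_iff_norm_tendsto_zero.mp hy)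
    rw [hA, coeff_rescale, norm_mul, norm_pow]
    exact mul_le_of_le_one_left (norm_nonneg _) (pow_le_one₀ (norm_nonneg _) hz)
  have hlim := tendsto_one_sub_mul_eval hAv
  set g : ℝ → ℂ := fun t => (1 - t * z) ^ (β : ℂ) - ξ * ((1 + t * z) / 2) ^ (β : ℂ) with hg
  have hg1 : g 1 = 0 := by
    rw [eval_charSeries h0 h1 ξ hz] at hroot
    simpa [hg] using hroot
  have hgd : DifferentiableAt ℝ g 1 := by
    have e1 : DifferentiableAt ℂ (fun s : ℂ => (1 - s * z) ^ (β : ℂ)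
        - ξ * ((1 + s * z) / 2) ^ (β : ℂ)) ((1 : ℝ) : ℂ) := by
      refine DifferentiableAt.sub ?_ (DifferentiableAt.const_mul ?_ _)
      · refine DifferentiableAt.cpow_const (by fun_prop) (Or.inl ?_)
        simpa using re_lt_one hz hz1
      · refine DifferentiableAt.cpow_const (by fun_prop) (Or.inl ?_)
        have := neg_one_lt_re hz hzm
        have e2 : ((1 + ((1 : ℝ) : ℂ) * z) / 2).re = (1 + z.re) / 2 := by
          rw [show (2 : ℂ) = ((2 : ℝ) : ℂ) by norm_num, Complex.div_ofReal_re]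
          simp
        rw [e2]
        linarith
    exact e1.hasDerivAt.comp_ofReal.differentiableAt
  have hO : g =O[𝓝[<] 1] fun t : ℝ => (1 - (t : ℂ)) := by
    have h2 := hgd.hasFDerivAt.isBigO_sub.mono (nhdsWithin_le_nhds (s := Set.Iio 1))
    simp only [hg1, sub_zero] at h2
    refine h2.trans (IsBigO.of_bound 1 (Eventually.of_forall fun t => ?_))
    rw [one_mul, ← Complex.ofReal_one, ← Complex.ofReal_sub, Complex.norm_real, norm_sub_rev]
  have hprod : Tendsto (fun t : ℝ => g t * eval A t) (𝓝[<] 1) (𝓝 0) :=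
    (hO.mul (isBigO_refl (fun t : ℝ => eval A t) _)).trans_tendsto hlim
  have hrhs : Tendsto (fun t : ℝ => c * (t * z) ^ k * (1 - t * z) ^ (β : ℂ)) (𝓝[<] 1)
      (𝓝 (c * z ^ k * (1 - z) ^ (β : ℂ))) := by
    have e3 : ContinuousAt (fun t : ℝ => c * (t * z) ^ k * (1 - t * z) ^ (β : ℂ)) 1 := by
      refine ContinuousAt.mul (by fun_prop) (ContinuousAt.cpow (by fun_prop) (by fun_prop) ?_)
      exact Or.inl (by simpa using re_lt_one hz hz1)
    have e4 := e3.tendsto.mono_left (nhdsWithin_le_nhds (s := Set.Iio 1))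
    simpa using e4
  have heq : (fun t : ℝ => g t * eval A t) =ᶠ[𝓝[<] 1]
      fun t : ℝ => c * (t * z) ^ k * (1 - t * z) ^ (β : ℂ) := by
    filter_upwards [Ioo_mem_nhdsLT (show (0 : ℝ) < 1 by norm_num)] with t ht
    have htz : ‖(t : ℂ) * z‖ < 1 := by
      rw [norm_mul, Complex.norm_real, Real.norm_of_nonneg ht.1.le]
      nlinarith [norm_nonneg z, ht.1, ht.2]
    obtain ⟨M, hM⟩ := hy.exists_bound
    have h5 := eval_charSeries_mul h0 h1 hM hD htz
    have h6 : eval A t = eval y ((t : ℂ) * z) := by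
      simp only [eval, hA, coeff_rescale]
      exact tsum_congr fun n => by rw [mul_pow]; ring
    rw [h6, ← h5]
  have hfin := tendsto_nhds_unique (hprod.congr' heq) hrhs
  refine mul_ne_zero (mul_ne_zero hc ?_) (one_sub_cpow_ne_zero β hz1) hfin.symm
  rcases hk with rfl | hk
  · simp
  · exact pow_ne_zero k hk

/-! ### Discrete Volterra equations -/

theorem coeff_omegaSeries_mul (β : ℝ) (y : ℕ → ℂ) (n : ℕ) :
    coeff n (omegaSeries β * PowerSeries.mk y)
      = ∑ j ∈ Finset.range (n + 1), omega β (n - j) * y j := by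
  rw [mul_comm, coeff_mul, Finset.Nat.sum_antidiagonal_eq_sum_range_succ
    (fun i j => coeff i (PowerSeries.mk y) * coeff j (omegaSeries β))]
  exact Finset.sum_congr rfl fun j _ => by rw [coeff_mk, omegaSeries, coeff_mk, mul_comm]

theorem coeff_one_sub_omegaSeries_mul (β : ℝ) (ξ : ℂ) (y : ℕ → ℂ) (n : ℕ) :
    coeff n ((1 - C ξ * omegaSeries β) * PowerSeries.mk y)
      = y n - ξ * ∑ j ∈ Finset.range (n + 1), omega β (n - j) * y j := by
  rw [sub_mul, one_mul, mul_assoc, map_sub, coeff_C_mul, coeff_omegaSeries_mul, coeff_mk]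

/-- The convolution equation as an identity of formal power series. -/
theorem volterra_iff (β : ℝ) (ξ : ℂ) (y g : ℕ → ℂ) :
    (∀ n, y n = g n + ξ * ∑ j ∈ Finset.range (n + 1), omega β (n - j) * y j) ↔
      (1 - C ξ * omegaSeries β) * PowerSeries.mk y = PowerSeries.mk g := by
  rw [PowerSeries.ext_iff]
  refine forall_congr' fun n => ?_
  rw [coeff_one_sub_omegaSeries_mul, coeff_mk, sub_eq_iff_eq_add]

theorem constantCoeff_one_sub_omegaSeries (β : ℝ) (ξ : ℂ) :
    constantCoeff (1 - C ξ * omegaSeries β) = 1 - ξ * omega β 0 := by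
  rw [map_sub, map_one, map_mul, constantCoeff_C, ← coeff_zero_eq_constantCoeff_apply,
    omegaSeries, coeff_mk]

theorem eval_charSeries_zero {β : ℝ} (h0 : 0 < β) (h1 : β < 1) (ξ : ℂ) :
    eval (charSeries β ξ) 0 = 1 - ξ * omega β 0 := by
  rw [eval, tsum_eq_single 0 (fun n hn => by simp [hn]), pow_zero, mul_one,
    coeff_zero_eq_constantCoeff_apply, ← one_sub_omegaSeries_mul h0 h1, map_mul,
    constantCoeff_one_sub_omegaSeries, ← coeff_zero_eq_constantCoeff_apply, coeff_oneSubPow,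
    subCoeff_zero, Complex.ofReal_one, mul_one]

theorem one_sub_mul_omega_zero_ne_zero {β : ℝ} (h0 : 0 < β) (h1 : β < 1) {ξ : ℂ}
    (hξ : ξ ∉ reciprocalValues β) : 1 - ξ * omega β 0 ≠ 0 := by
  rw [← eval_charSeries_zero h0 h1]
  exact eval_charSeries_ne_zero h0 h1 hξ (by simp)

theorem exists_volterra {β : ℝ} {ξ : ℂ} (hc : 1 - ξ * omega β 0 ≠ 0) (g : ℕ → ℂ) :
    ∃ y : ℕ → ℂ, (1 - C ξ * omegaSeries β) * PowerSeries.mk y = PowerSeries.mk g := by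
  rw [← constantCoeff_one_sub_omegaSeries] at hc
  refine ⟨fun n => coeff n ((1 - C ξ * omegaSeries β)⁻¹ * PowerSeries.mk g), ?_⟩
  have h1 : PowerSeries.mk (fun n => coeff n ((1 - C ξ * omegaSeries β)⁻¹ * PowerSeries.mk g))
      = (1 - C ξ * omegaSeries β)⁻¹ * PowerSeries.mk g := by
    ext n; rw [coeff_mk]
  rw [h1, ← mul_assoc, PowerSeries.mul_inv_cancel _ hc, one_mul]

theorem eq_of_volterra {β : ℝ} {ξ : ℂ} (hc : 1 - ξ * omega β 0 ≠ 0) {y y' : ℕ → ℂ}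
    (h : (1 - C ξ * omegaSeries β) * PowerSeries.mk y
      = (1 - C ξ * omegaSeries β) * PowerSeries.mk y') : y = y' := by
  have hne : 1 - C ξ * omegaSeries β ≠ 0 := fun h2 => hc (by
    rw [← constantCoeff_one_sub_omegaSeries, h2, map_zero])
  have h3 := mul_left_cancel₀ hne h
  funext n
  have := congrArg (coeff n) h3
  simpa using this

theorem convStabilityRegion_omega {β : ℝ} (h0 : 0 < β) (h1 : β < 1) :
    convStabilityRegion (omega β) = (reciprocalValues β)ᶜ := by
  ext ξ
  simp only [convStabilityRegion, volterra_iff, Set.mem_ofPred_eq, Set.mem_compl_iff]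
  constructor
  · intro h hξ
    by_cases hξ0 : ξ = 0
    · obtain ⟨y, hy, -, hlim⟩ := h (fun _ => 1) 1 tendsto_const_nhds
      have h2 := (volterra_iff β ξ y fun _ => 1).mpr hy
      have h3 : y = fun _ => 1 := by
        funext n
        rw [h2 n, hξ0, zero_mul, add_zero]
      rw [h3] at hlim
      exact one_ne_zero (tendsto_nhds_unique tendsto_const_nhds hlim)
    · obtain ⟨z, hz, hz1, hzm, hroot⟩ := exists_eval_charSeries_eq_zero h0 h1 hξ hξ0
      obtain ⟨y, hy, -, hlim⟩ := h (fun n => if n = 0 then 1 else 0) 0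
        (tendsto_const_nhds.congr' (by
          filter_upwards [eventually_ne_atTop 0] with n hn
          rw [if_neg hn]))
      refine not_vanishing_of_root h0 h1 hz hz1 hzm hroot (y := PowerSeries.mk y)
        (by simpa [Vanishing] using hlim) one_ne_zero (k := 0) (Or.inl rfl) (hy.trans ?_)
      ext n
      simp [coeff_one]
  · intro hξ g l hg
    have hc := one_sub_mul_omega_zero_ne_zero h0 h1 hξ
    obtain ⟨y, hy⟩ := exists_volterra hc g
    exact ⟨y, hy, fun y' hy' => eq_of_volterra hc (hy'.trans hy.symm),
      tendsto_zero_of_volterra h0 h1 hξ (fracNull_of_tendsto h0 h1 hg) hy⟩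

/-! ### The contribution of the correction terms -/

/-- The correction terms of `fracQuad`, without the factor `h ^ β`. -/
def quadCorrection (β : ℝ) (θ : ℕ → ℝ) (m : ℕ) (V : ℕ → ℂ) (n : ℕ) : ℂ :=
  ∑ k : Fin m, quadWeight β θ m n k * V (k + 1) + quadWeightZero β θ m n * V 0

/-- Everything in the scheme for `f(t, u) = ρ u` except the two convolution sums, which combine to
`(λ + ρ) h ^ β` times one convolution. It depends only on the values below the first level. The
terms of `f` outside the weights cancel, since `f` is linear. -/
def forcing (β h : ℝ) (K : Corrections) (lam rho : ℂ) (V : ℕ → ℂ) (n : ℕ) : ℂ :=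
  V 0 + ((h ^ β : ℝ) : ℂ) * (lam * quadCorrection β K.σ K.mu V n
      + rho * quadCorrection β K.δ K.mf V n)
    + ((h ^ β : ℝ) : ℂ) * omega β 0 * rho *
      (∑ k : Fin K.mu', taylorWeightU K.σ K.mu' n k * (V (k + 1) - V 0)
        + ∑ k : Fin K.mf', taylorWeightF K.δ K.mf' n k * (V (k + 1) - V 0))

theorem schemeEq_iff (β h : ℝ) (K : Corrections) (lam rho : ℂ) (U : ℕ → ℂ) (n : ℕ) :
    SchemeEq β h K lam (fun _ u => rho * u) U n ↔
      U n = forcing β h K lam rho U n + (lam + rho) * ((h ^ β : ℝ) : ℂ) *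
        ∑ k ∈ Finset.range (n + 1), omega β (n - k) * U k := by
  have e1 : deriv (fun x : ℂ => rho * x) (U (n - 1)) = rho := by simp
  have e2 : ∑ k ∈ Finset.range (n + 1), omega β (n - k) * (rho * U k)
      = rho * ∑ k ∈ Finset.range (n + 1), omega β (n - k) * U k := by
    rw [Finset.mul_sum]; exact Finset.sum_congr rfl fun k _ => by ring
  have e3 : ∀ (m : ℕ) (w : Fin m → ℂ), ∑ k : Fin m, w k * (rho * U (k + 1))
      = rho * ∑ k : Fin m, w k * U (k + 1) := fun m w => by
    rw [Finset.mul_sum]; exact Finset.sum_congr rfl fun k _ => by ring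
  have e4 : ∀ (m : ℕ) (w : Fin m → ℂ), ∑ k : Fin m, w k * (rho * U (k + 1) - rho * U 0)
      = rho * ∑ k : Fin m, w k * (U (k + 1) - U 0) := fun m w => by
    rw [Finset.mul_sum]; exact Finset.sum_congr rfl fun k _ => by ring
  simp only [SchemeEq, fracQuad, deriv_const, e1, e2, e3, e4, forcing, quadCorrection]
  refine Eq.congr_right ?_
  ring

theorem Corrections.lt_firstLevel (K : Corrections) :
    0 < K.firstLevel ∧ K.mu < K.firstLevel ∧ K.mf < K.firstLevel ∧ K.mu' < K.firstLevel ∧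
      K.mf' < K.firstLevel := by
  simp only [Corrections.firstLevel]
  omega

theorem forcing_congr (β h : ℝ) (K : Corrections) (lam rho : ℂ) {U V : ℕ → ℂ}
    (hUV : ∀ k < K.firstLevel, U k = V k) : forcing β h K lam rho U = forcing β h K lam rho V := by
  obtain ⟨l0, l1, l2, l3, l4⟩ := K.lt_firstLevel
  have hk : ∀ m, m < K.firstLevel → ∀ k : Fin m, U (k + 1) = V (k + 1) := fun m hm k =>
    hUV _ (by omega)
  funext n
  simp only [forcing, quadCorrection, hUV 0 l0, hk _ l1, hk _ l2, hk _ l3, hk _ l4]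

/-- The error of the uncorrected quadrature for `t ^ θ` at `t = n`, with step size `1`. -/
def quadError (β θ : ℝ) (n : ℕ) : ℂ :=
  ((Real.Gamma (θ + 1) / Real.Gamma (θ + 1 + β) * (n : ℝ) ^ (θ + β) : ℝ) : ℂ)
    - ∑ k ∈ Finset.range (n + 1), omega β (n - k) * (((k : ℝ) ^ θ : ℝ) : ℂ)

theorem fracNull_quadError {β θ : ℝ} (h0 : 0 < β) (h1 : β < 1) (hθ0 : 0 ≤ θ) (hθ : θ < 2) :
    FracNull β (quadError β θ) := by
  have hΓ : Real.Gamma (θ + 1) ≠ 0 := (Real.Gamma_pos_of_pos (by linarith)).ne'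
  have h2 : PowerSeries.mk (quadError β θ) = C (Real.Gamma (θ + 1) : ℂ) *
      (gridPow (θ + β) - omegaSeries β * gridPow θ) := by
    ext n
    rw [coeff_mk, coeff_C_mul, map_sub]
    simp only [gridPow]
    rw [coeff_omegaSeries_mul, coeff_mk, quadError, mul_sub, Finset.mul_sum]
    congr 1
    · rw [show θ + β + 1 = θ + 1 + β by ring]
      push_cast
      ring
    · refine Finset.sum_congr rfl fun k _ => ?_
      push_cast
      have : (Real.Gamma (θ + 1) : ℂ) ≠ 0 := by exact_mod_cast hΓ
      field_simp
  have h3 : oneSubPow β * PowerSeries.mk (quadError β θ) = C (Real.Gamma (θ + 1) : ℂ) *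
      (oneSubPow β * gridPow (θ + β) - halfAddPow β * gridPow θ) := by
    rw [h2, ← omegaSeries_mul h0 h1]; ring
  rw [FracNull, h3]
  exact (vanishing_quadrature_error h0 h1 hθ0 hθ).C_mul _

/-- The error of the first order Taylor expansion of `t ^ δ` at `t = n - 1`, evaluated at `t = n`. -/
def taylorError (δ : ℝ) (n : ℕ) : ℂ :=
  (((n : ℝ) ^ δ - ((n : ℝ) - 1) ^ δ - δ * ((n : ℝ) - 1) ^ (δ - 1) : ℝ) : ℂ)

theorem fracNull_taylorError {β δ : ℝ} (h0 : 0 < β) (h1 : β < 1) (hδ0 : 0 < δ)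
    (hδ : δ < 2 + β) : FracNull β (taylorError δ) := by
  have hΓ : Real.Gamma δ ≠ 0 := (Real.Gamma_pos_of_pos hδ0).ne'
  have h2 : FracNull β fun n => (Real.Gamma (δ + 1) : ℂ) *
      coeff n ((1 - X) * gridPow δ - X * gridPow (δ - 1)) := by
    refine FracNull.const_mul ?_ _
    rw [FracNull]
    have : PowerSeries.mk (fun n => coeff n ((1 - X) * gridPow δ - X * gridPow (δ - 1)))
        = (1 - X) * gridPow δ - X * gridPow (δ - 1) := by ext n; rw [coeff_mk]
    rw [this]
    exact vanishing_taylor_error h0 h1 hδ0 hδ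
  refine h2.congr' h0 ?_
  filter_upwards [eventually_ge_atTop 1] with n hn
  obtain ⟨m, rfl⟩ : ∃ m, n = m + 1 := ⟨n - 1, by omega⟩
  rw [map_sub, coeff_succ_one_sub_X_mul, coeff_succ_X_mul]
  simp only [gridPow, coeff_mk, taylorError]
  rw [sub_add_cancel, Real.Gamma_add_one hδ0.ne', Nat.cast_succ, add_sub_cancel_right]
  push_cast
  have e1 : (Real.Gamma δ : ℂ) ≠ 0 := by exact_mod_cast hΓ
  have e2 : (δ : ℂ) ≠ 0 := by exact_mod_cast hδ0.ne'
  field_simp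

theorem fracNull_solveWeights {β : ℝ} (θ : ℕ → ℝ) (m : ℕ) {b : ℕ → ℕ → ℂ}
    (hb : ∀ r < m, FracNull β (b r)) (k : Fin m) :
    FracNull β fun n => solveWeights θ m (fun r => b r n) k := by
  unfold solveWeights
  exact FracNull.sum _ fun r _ => (hb r r.2).const_mul _

/-- By the choice of the zeroth weight, the corrections act on the increments `V (k + 1) - V 0`,
up to the quadrature error for constants (`θ = 0`). -/
theorem quadCorrection_eq (β : ℝ) (θ : ℕ → ℝ) (m : ℕ) (V : ℕ → ℂ) (n : ℕ) :
    quadCorrection β θ m V n = ∑ k : Fin m, quadWeight β θ m n k * (V (k + 1) - V 0)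
      + quadError β 0 n * V 0 := by
  have h : quadWeightZero β θ m n = quadError β 0 n - ∑ k : Fin m, quadWeight β θ m n k := by
    simp [quadWeightZero, quadError, div_eq_inv_mul]
  simp only [quadCorrection, h, mul_sub, Finset.sum_sub_distrib, ← Finset.sum_mul]
  ring

theorem fracNull_quadCorrection {β : ℝ} (h0 : 0 < β) (h1 : β < 1) {θ : ℕ → ℝ} {m : ℕ}
    (hθ0 : ∀ r, 0 < θ r) (hθ : ∀ r < m, θ r < 2) (V : ℕ → ℂ) :
    FracNull β (quadCorrection β θ m V) := by
  have h2 : quadCorrection β θ m V = fun n =>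
      ∑ k : Fin m, quadWeight β θ m n k * (V (k + 1) - V 0) + quadError β 0 n * V 0 :=
    funext fun n => quadCorrection_eq β θ m V n
  rw [h2]
  refine FracNull.add (FracNull.sum _ fun k _ => FracNull.mul_const ?_ _)
    ((fracNull_quadError h0 h1 le_rfl two_pos).mul_const _)
  exact fracNull_solveWeights θ m (b := fun r n => quadError β (θ r) n)
    (fun r hr => fracNull_quadError h0 h1 (hθ0 r).le (hθ r hr)) k

theorem fracNull_taylorWeightF {β : ℝ} (h0 : 0 < β) (h1 : β < 1) {δ : ℕ → ℝ} {m : ℕ}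
    (hδ0 : ∀ r, 0 < δ r) (hδ : ∀ r < m, δ r < 2 + β) (k : Fin m) :
    FracNull β fun n => taylorWeightF δ m n k :=
  fracNull_solveWeights δ m (b := fun r n => taylorError (δ r) n)
    (fun r hr => fracNull_taylorError h0 h1 (hδ0 r) (hδ r hr)) k

theorem taylorWeightU_eq_neg (σ : ℕ → ℝ) (m n : ℕ) (k : Fin m) :
    taylorWeightU σ m n k = -1 * taylorWeightF σ m n k := by
  simp only [taylorWeightU, taylorWeightF, solveWeights, Finset.mul_sum]
  refine Finset.sum_congr rfl fun r _ => ?_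
  push_cast
  ring

theorem fracNull_forcing {β : ℝ} (h0 : 0 < β) (h1 : β < 1) (h : ℝ) {K : Corrections}
    (hσ0 : ∀ r, 0 < K.σ r) (hδ0 : ∀ r, 0 < K.δ r)
    (hmu : ∀ r < K.mu, K.σ r < 2) (hmf : ∀ r < K.mf, K.δ r < 2)
    (hmu' : ∀ r < K.mu', K.σ r < 2 + β) (hmf' : ∀ r < K.mf', K.δ r < 2 + β)
    (lam rho : ℂ) (V : ℕ → ℂ) : FracNull β (forcing β h K lam rho V) := by
  unfold forcing
  simp only [taylorWeightU_eq_neg]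
  refine FracNull.add (FracNull.add (fracNull_const h0 _) (FracNull.const_mul (FracNull.add
    ((fracNull_quadCorrection h0 h1 hσ0 hmu V).const_mul _)
    ((fracNull_quadCorrection h0 h1 hδ0 hmf V).const_mul _)) _))
    (FracNull.const_mul (FracNull.add (FracNull.sum _ fun k _ => FracNull.mul_const ?_ _)
      (FracNull.sum _ fun k _ => FracNull.mul_const ?_ _)) _)
  · exact (fracNull_taylorWeightF h0 h1 hσ0 hmu' k).const_mul _
  · exact fracNull_taylorWeightF h0 h1 hδ0 hmf' k

/-! ### Test runs of the scheme -/

/-- The right-hand side of the Volterra equation on all of `ℕ` that a test run satisfies: below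
the starting level `N` it is chosen such that the equation prescribes the starting values. -/
def runForcing (β h : ℝ) (K : Corrections) (lam rho : ℂ) (N : ℕ) (V : ℕ → ℂ) (n : ℕ) : ℂ :=
  if n < N then V n - (lam + rho) * ((h ^ β : ℝ) : ℂ) *
    ∑ j ∈ Finset.range (n + 1), omega β (n - j) * V j
  else forcing β h K lam rho V n

theorem volterra_of_isTestRun {β h : ℝ} {K : Corrections} {lam rho : ℂ} {N : ℕ}
    (hN : K.firstLevel ≤ N) {V U : ℕ → ℂ} (hU : IsTestRun β h K lam rho N V U) :
    (1 - C ((lam + rho) * ((h ^ β : ℝ) : ℂ)) * omegaSeries β) * PowerSeries.mk U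
      = PowerSeries.mk (runForcing β h K lam rho N V) := by
  rw [← volterra_iff]
  intro n
  rw [runForcing]
  split_ifs with hn
  · have hs : ∑ j ∈ Finset.range (n + 1), omega β (n - j) * U j
        = ∑ j ∈ Finset.range (n + 1), omega β (n - j) * V j :=
      Finset.sum_congr rfl fun j hj => by
        rw [hU.1 j (by have := Finset.mem_range.mp hj; omega)]
    rw [hs, hU.1 n hn, sub_add_cancel]
  · rw [← forcing_congr β h K lam rho (U := U) (V := V) fun k hk => hU.1 k (by omega)]
    exact (schemeEq_iff β h K lam rho U n).mp (hU.2 n (by omega))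

theorem isTestRun_of_volterra {β h : ℝ} {K : Corrections} {lam rho : ℂ} {N : ℕ}
    (hN : K.firstLevel ≤ N) (hc : 1 - (lam + rho) * ((h ^ β : ℝ) : ℂ) * omega β 0 ≠ 0)
    {V U : ℕ → ℂ}
    (hU : (1 - C ((lam + rho) * ((h ^ β : ℝ) : ℂ)) * omegaSeries β) * PowerSeries.mk U
      = PowerSeries.mk (runForcing β h K lam rho N V)) : IsTestRun β h K lam rho N V U := by
  rw [← volterra_iff] at hU
  have hstart : ∀ k < N, U k = V k := by
    intro n
    induction n using Nat.strong_induction_on with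
    | _ n ih =>
      intro hn
      have h2 := hU n
      have hs : ∑ j ∈ Finset.range n, omega β (n - j) * U j
          = ∑ j ∈ Finset.range n, omega β (n - j) * V j :=
        Finset.sum_congr rfl fun j hj => by
          have := Finset.mem_range.mp hj
          rw [ih j this (by omega)]
      rw [runForcing, if_pos hn, Finset.sum_range_succ, Finset.sum_range_succ, hs,
        Nat.sub_self] at h2
      have h3 : (1 - (lam + rho) * ((h ^ β : ℝ) : ℂ) * omega β 0) * (U n - V n) = 0 := by
        linear_combination h2
      exact sub_eq_zero.mp ((mul_eq_zero.mp h3).resolve_left hc)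
  refine ⟨hstart, fun n hn => ?_⟩
  rw [schemeEq_iff, forcing_congr β h K lam rho (V := V) fun k hk => hstart k (by omega)]
  have h2 := hU n
  rwa [runForcing, if_neg (by omega)] at h2

theorem isStableFor_of_notMem {β : ℝ} (h0 : 0 < β) (h1 : β < 1) (h : ℝ) {K : Corrections}
    (hσ0 : ∀ r, 0 < K.σ r) (hδ0 : ∀ r, 0 < K.δ r)
    (hmu : ∀ r < K.mu, K.σ r < 2) (hmf : ∀ r < K.mf, K.δ r < 2)
    (hmu' : ∀ r < K.mu', K.σ r < 2 + β) (hmf' : ∀ r < K.mf', K.δ r < 2 + β)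
    {lam rho : ℂ} (hξ : (lam + rho) * ((h ^ β : ℝ) : ℂ) ∉ reciprocalValues β) :
    IsStableFor β h K lam rho := by
  intro N hN V
  have hc := one_sub_mul_omega_zero_ne_zero h0 h1 hξ
  obtain ⟨U, hU⟩ := exists_volterra hc (runForcing β h K lam rho N V)
  refine ⟨U, isTestRun_of_volterra hN hc hU, fun U' hU' =>
    eq_of_volterra hc ((volterra_of_isTestRun hN hU').trans hU.symm),
    tendsto_zero_of_volterra h0 h1 hξ ?_ hU⟩
  refine (fracNull_forcing h0 h1 h hσ0 hδ0 hmu hmf hmu' hmf' lam rho V).congr' h0 ?_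
  filter_upwards [eventually_ge_atTop N] with n hn
  rw [runForcing, if_neg (by omega)]

/-- For `λ + ρ = 0`, constants solve the scheme: the corrections are exact for them. -/
theorem forcing_one (β h : ℝ) (K : Corrections) {lam rho : ℂ}
    (hξ : (lam + rho) * ((h ^ β : ℝ) : ℂ) = 0) (n : ℕ) :
    forcing β h K lam rho (fun _ => 1) n = 1 := by
  simp only [forcing, quadCorrection_eq, sub_self, mul_zero, Finset.sum_const_zero, zero_add,
    mul_one, add_zero]
  linear_combination quadError β 0 n * hξ

theorem forcing_eq_zero (β h : ℝ) (K : Corrections) (lam rho : ℂ) {V : ℕ → ℂ}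
    (hV : ∀ k < K.firstLevel, V k = 0) (n : ℕ) : forcing β h K lam rho V n = 0 := by
  rw [forcing_congr β h K lam rho (V := fun _ => 0) hV]
  simp [forcing, quadCorrection]

/-- For `ξ = 0` the constant solution does not decay. For `ξ ≠ 0` the scheme is started one level
late, with starting values that vanish except for the last: then no correction is active, and the
solution is that of `(1 - ξ ω) U = (1 - ξ ω_0) X ^ N`. -/
theorem not_isStableFor_of_mem {β : ℝ} (h0 : 0 < β) (h1 : β < 1) (h : ℝ) (K : Corrections)
    {lam rho : ℂ} (hξ : (lam + rho) * ((h ^ β : ℝ) : ℂ) ∈ reciprocalValues β) :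
    ¬ IsStableFor β h K lam rho := by
  intro hst
  set ξ := (lam + rho) * ((h ^ β : ℝ) : ℂ) with hξdef
  by_cases hξ0 : ξ = 0
  · obtain ⟨U, hU, -, hlim⟩ := hst _ le_rfl fun _ => 1
    have h2 : ∀ᶠ n in atTop, U n = 1 := by
      filter_upwards [eventually_ge_atTop K.firstLevel] with n hn
      rw [(schemeEq_iff β h K lam rho U n).mp (hU.2 n hn), ← hξdef, hξ0, zero_mul, add_zero,
        forcing_congr β h K lam rho hU.1, forcing_one β h K (hξdef.symm.trans hξ0)]
    exact zero_ne_one (tendsto_nhds_unique hlim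
      (tendsto_const_nhds.congr' (h2.mono fun n hn => hn.symm)))
  · set N := K.firstLevel with hNdef
    obtain ⟨U, hU, -, hlim⟩ := hst (N + 1) (Nat.le_succ N) fun k => if k = N then 1 else 0
    have hU0 : ∀ k < N, U k = 0 := fun k hk => by
      rw [hU.1 k (by omega)]; exact if_neg (by omega)
    have hUN : U N = 1 := by rw [hU.1 N (by omega)]; exact if_pos rfl
    have hser : (1 - C ξ * omegaSeries β) * PowerSeries.mk U
        = C (1 - ξ * omega β 0) * X ^ N := by
      ext n
      rw [coeff_one_sub_omegaSeries_mul, coeff_C_mul, coeff_X_pow]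
      rcases lt_trichotomy n N with hn | rfl | hn
      · rw [if_neg hn.ne, mul_zero, hU0 n hn, Finset.sum_eq_zero, mul_zero, sub_zero]
        intro j hj
        rw [hU0 j (by have := Finset.mem_range.mp hj; omega), mul_zero]
      · rw [if_pos rfl, mul_one, Finset.sum_range_succ, Finset.sum_eq_zero, hUN, Nat.sub_self,
          zero_add, mul_one]
        intro j hj
        rw [hU0 j (Finset.mem_range.mp hj), mul_zero]
      · rw [if_neg hn.ne', mul_zero, sub_eq_zero]
        have h2 := (schemeEq_iff β h K lam rho U n).mp (hU.2 n hn)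
        rwa [forcing_eq_zero β h K lam rho hU0, zero_add] at h2
    obtain ⟨z, hz, hz1, hzm, hroot⟩ := exists_eval_charSeries_eq_zero h0 h1 hξ hξ0
    -- if the implicit equation degenerates, the power series identity contradicts `U N = 1`
    by_cases hc : 1 - ξ * omega β 0 = 0
    · rw [hc, map_zero, zero_mul] at hser
      rcases mul_eq_zero.mp hser with h2 | h2
      · have h3 := eval_charSeries h0 h1 ξ (z := 1) (by simp)
        rw [← one_sub_omegaSeries_mul h0 h1, h2, zero_mul, sub_self,
          Complex.zero_cpow (by exact_mod_cast h0.ne')] at h3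
        norm_num [eval] at h3
        exact hξ0 h3
      · have h3 := congrArg (coeff N) h2
        rw [coeff_mk, hUN, map_zero] at h3
        exact one_ne_zero h3
    · refine not_vanishing_of_root h0 h1 hz hz1 hzm hroot (by simpa [Vanishing] using hlim) hc
        (Or.inr fun hz0 => hc ?_) hser
      rw [hz0] at hroot
      rw [← eval_charSeries_zero h0 h1, hroot]

/-! ### The sector -/

/-- On the closed disc, `|arg ω^{(β)}(z)| ≤ β π / 2`. -/
theorem isAStable_compl_reciprocalValues {β : ℝ} (h0 : 0 < β) (h1 : β < 1) :
    IsAStable (β * Real.pi / 2) (reciprocalValues β)ᶜ := by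
  intro s hs
  rw [Set.mem_ofPred_eq] at hs
  rintro (rfl | ⟨z, hz, hz1, hzm, rfl⟩)
  · rw [Complex.arg_zero, abs_zero] at hs
    have := Real.pi_pos
    have : 0 < β * Real.pi / 2 := by positivity
    linarith
  · rw [one_div, Complex.abs_arg_inv] at hs
    refine absurd hs (not_lt.mpr ?_)
    have hv : 1 - z ≠ 0 := sub_ne_zero.mpr (Ne.symm hz1)
    have hu : 1 + z ≠ 0 := fun h => hzm (by linear_combination h)
    have hw0 : 1 / 2 * ((1 + z) / (1 - z)) ≠ 0 := mul_ne_zero (by norm_num) (div_ne_zero hu hv)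
    have ha := Complex.abs_arg_le_pi_div_two_iff.mpr (re_moebius_nonneg hz)
    rw [genFun]
    generalize 1 / 2 * ((1 + z) / (1 - z)) = w at hw0 ha
    have him : (Complex.log w * β).im = w.arg * β := by
      rw [Complex.im_mul_ofReal, Complex.log_im]
    have hab : |w.arg * β| ≤ β * Real.pi / 2 := by
      rw [abs_mul, abs_of_pos h0]
      nlinarith
    have hpi : β * Real.pi / 2 < Real.pi := by nlinarith [Real.pi_pos]
    rw [Complex.cpow_def_of_ne_zero hw0, Complex.arg_exp, him,
      toIocMod_eq_self (by positivity) |>.mpr]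
    · exact hab
    · rw [abs_le] at hab
      exact ⟨by linarith [hab.1], by linarith [hab.2]⟩

end IMEXT
end

theorem theorem3p4 (β : ℝ) (hβ₀ : 0 < β) (hβ₁ : β < 1) (C : IMEXT.Corrections)
    (hσ₀ : 0 < C.σ 0) (hσ : StrictMono C.σ) (hδ₀ : 0 < C.δ 0) (hδ : StrictMono C.δ)
    (hmu : ∀ r < C.mu, C.σ r < 2) (hmf : ∀ r < C.mf, C.δ r < 2)
    (hmu' : ∀ r < C.mu', C.σ r < 2 + β) (hmf' : ∀ r < C.mf', C.δ r < 2 + β) :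
    (∀ (lam rho : ℂ) (h : ℝ), 0 < h →
      (IMEXT.IsStableFor β h C lam rho ↔
        (lam + rho) * ((h ^ β : ℝ) : ℂ) ∉ IMEXT.reciprocalValues β)) ∧
    IMEXT.stabilityRegion β C = (IMEXT.reciprocalValues β)ᶜ ∧
    IMEXT.stabilityRegion β C = IMEXT.convStabilityRegion (IMEXT.omega β) ∧
    IMEXT.IsAStable (β * Real.pi / 2) (IMEXT.stabilityRegion β C) := by
  have hσ0 : ∀ r, 0 < C.σ r := fun r => hσ₀.trans_le (hσ.monotone (Nat.zero_le r))
  have hδ0 : ∀ r, 0 < C.δ r := fun r => hδ₀.trans_le (hδ.monotone (Nat.zero_le r))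
  have hiff : ∀ (lam rho : ℂ) (h : ℝ), IMEXT.IsStableFor β h C lam rho ↔
      (lam + rho) * ((h ^ β : ℝ) : ℂ) ∉ IMEXT.reciprocalValues β := fun lam rho h =>
    ⟨fun hs hm => IMEXT.not_isStableFor_of_mem hβ₀ hβ₁ h C hm hs,
      IMEXT.isStableFor_of_notMem hβ₀ hβ₁ h hσ0 hδ0 hmu hmf hmu' hmf'⟩
  have hreg : IMEXT.stabilityRegion β C = (IMEXT.reciprocalValues β)ᶜ := by
    ext ξ
    constructor
    · intro hξ
      have h1 := (hiff ξ 0 1).mp (hξ ξ 0 1 one_pos (by simp))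
      simpa using h1
    · rintro hξ lam rho h - rfl
      exact (hiff lam rho h).mpr hξ
  refine ⟨fun lam rho h _ => hiff lam rho h, hreg, ?_, ?_⟩
  · rw [hreg, IMEXT.convStabilityRegion_omega hβ₀ hβ₁]
  · rw [hreg]
    exact IMEXT.isAStable_compl_reciprocalValues hβ₀ hβ₁
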